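/- Let $G$ be a compact Lie group and $H\subset G$ a closed subgroup such that $M=G/H$, with its quotient manifold structure (the one for which $G\to G/H$ is a smooth submersion), is connected and the action of $G$ on $M$ is almost effective, i.e. $\bigcap_{a\in G}aHa^{-1}$ is finite. Let $Q$ be an $\mathrm{Ad}(G)$-invariant Euclidean inner product on $\mathfrak g=\mathrm{Lie}(G)$, let $\mathfrak h=\mathrm{Lie}(H)$ and let $\mathfrak m$ be the $Q$-orthogonal complement of $\mathfrak h$ in $\mathfrak g$. A $G$-invariant Riemannian metric $g$ on $M$ is identified with the inner product that it induces on $\mathfrak m\cong T_{eH}M$, and the eigenvalues of $g$ are those of the $Q$-symmetric endomorphism $A_g$ of $\mathfrak m$ with $g=Q(A_g\,\cdot\,,\,\cdot\,)$. Write $\mu_{\mathfrak h}:\mathfrak m\wedge\mathfrak m\to\mathfrak h$ and $\mu_{\mathfrak m}:\mathfrak m\wedge\mathfrak m\to\mathfrak m$ for the components, with respect to the $Q$-orthogonal projections, of the Lie bracket of $\mathfrak g$ restricted to $\mathfrak m$, and, for a $g$-orthonormal basis $(f_\alpha)$ of $\mathfrak m$, put $$|\mu_{\mathfrak h}|_{Q_{\mathfrak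 h}+g}^2=\sum_{\alpha,\beta}Q\big([f_\alpha,f_\beta]_{\mathfrak h},[f_\alpha,f_\beta]_{\mathfrak h}\big),\qquad |\mu_{\mathfrak m}|_g^2=\sum_{\alpha,\beta}g\big([f_\alpha,f_\beta]_{\mathfrak m},[f_\alpha,f_\beta]_{\mathfrak m}\big)$$ (both are independent of the basis). Proposition. Let $(g^{(n)})_{n\in\mathbb N}$ be a sequence of smooth $G$-invariant Riemannian metrics on $M$ such that the smallest eigenvalue of every $g^{(n)}$ is $1$. If $(g^{(n)})$ has bounded curvature, i.e. there is a constant $C>0$ with $|\sec(g^{(n)})|\le C$ on all tangent planes of $M$ for all $n$, then $(g^{(n)})$ is algebraically non-collapsed, i.e. there is a constant $C'>0$ such that $$|\mu_{\mathfrak h}|_{Q_{\mathfrak h}+g^{(n)}}^2+|\mu_{\mathfrak m}|_{g^{(n)}}^2<C'\qquad\text{for all } n\in\mathbb N .$$ -/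

import Mathlib

open Bundle Manifold
open scoped ContDiff

noncomputable section

/-! ### Riemannian metrics, the Levi-Civita connection, sectional curvature -/

section Riemannian

variable (F : Type*) [NormedAddCommGroup F] [NormedSpace ℝ F] [FiniteDimensional ℝ F]
  (M : Type*) [TopologicalSpace M] [ChartedSpace F M] [IsManifold 𝓘(ℝ, F) ∞ M]

/-- Smooth Riemannian metrics on the smooth manifold `M` (without boundary, modelled on `F`). -/
abbrev SmoothMetric : Type _ :=
  ContMDiffRiemannianMetric 𝓘(ℝ, F) ∞ F (fun x : M => TangentSpace 𝓘(ℝ, F) x)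

/-- Affine connections on `M`. The vector `∇_v Y` at `x`, for `v ∈ T_x M`, is `conn Y x v`. -/
abbrev AffineConnection : Type _ :=
  CovariantDerivative 𝓘(ℝ, F) F (fun x : M => TangentSpace 𝓘(ℝ, F) x)

variable {F M}

/-- `conn` is the Levi-Civita connection of `g`: it is smooth (it maps smooth vector fields to
smooth tensor fields), torsion free, and compatible with `g`, that is,
`v(g(Y, Z)) = g(∇_v Y, Z) + g(Y, ∇_v Z)`. -/
structure IsLeviCivita (g : SmoothMetric F M) (conn : AffineConnection F M) : Prop where
  smooth : CovariantDerivative.ContMDiffCovariantDerivative conn ∞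
  torsion_free : conn.torsion = 0
  metric : ∀ (x : M) (v : TangentSpace 𝓘(ℝ, F) x) (Y Z : Π y : M, TangentSpace 𝓘(ℝ, F) y),
    MDiffAt (T% Y) x → MDiffAt (T% Z) x →
      mfderiv 𝓘(ℝ, F) 𝓘(ℝ, ℝ) (fun y => g.inner y (Y y) (Z y)) x v =
        g.inner x (conn Y x v) (Z x) + g.inner x (Y x) (conn Z x v)

/-- The curvature `R(X, Y)Z = ∇_X ∇_Y Z - ∇_Y ∇_X Z - ∇_{[X, Y]} Z` on vector fields, at `x`. -/
def curvature (conn : AffineConnection F M) (X Y Z : Π y : M, TangentSpace 𝓘(ℝ, F) y) (x : M) :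
    TangentSpace 𝓘(ℝ, F) x :=
  conn (fun y => conn Z y (Y y)) x (X x) - conn (fun y => conn Z y (X y)) x (Y x)
    - conn Z x (VectorField.mlieBracket 𝓘(ℝ, F) X Y x)

/-- The sectional curvature at `x` of the plane spanned by `X x` and `Y x` (meant for `X x` and
`Y x` linearly independent). -/
def sectionalCurvature (g : SmoothMetric F M) (conn : AffineConnection F M)
    (X Y : Π y : M, TangentSpace 𝓘(ℝ, F) y) (x : M) : ℝ :=
  g.inner x (curvature conn X Y Y x) (X x) /
    (g.inner x (X x) (X x) * g.inner x (Y x) (Y x) - g.inner x (X x) (Y x) ^ 2)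

/-- `|sec(g)| ≤ C` on all tangent planes of `M`. -/
def SecBoundedBy (g : SmoothMetric F M) (C : ℝ) : Prop :=
  ∃ conn : AffineConnection F M, IsLeviCivita g conn ∧
    ∀ X Y : Π y : M, TangentSpace 𝓘(ℝ, F) y, CMDiff ∞ (T% X) → CMDiff ∞ (T% Y) →
      ∀ x : M, LinearIndependent ℝ ![X x, Y x] → |sectionalCurvature g conn X Y x| ≤ C

/-- A sequence of metrics has bounded curvature: `|sec(g⁽ⁿ⁾)| ≤ C` with `C` independent of `n`. -/
def HasBoundedCurvature (g : ℕ → SmoothMetric F M) : Prop :=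
  ∃ C : ℝ, 0 < C ∧ ∀ n, SecBoundedBy (g n) C

end Riemannian

/-! ### Inner products on the Lie algebra -/

section LieAlgebra

variable {E : Type*} [NormedAddCommGroup E] [NormedSpace ℝ E]
  (G : Type*) [TopologicalSpace G] [ChartedSpace E G] [Group G]

/-- The adjoint action of `a` on the Lie algebra: the differential at `1` of `x ↦ a x a⁻¹`. -/
def adjointAction {G : Type*} [TopologicalSpace G] [ChartedSpace E G] [Group G] (a : G) :
    GroupLieAlgebra 𝓘(ℝ, E) G → GroupLieAlgebra 𝓘(ℝ, E) G :=
  fun X => mfderiv 𝓘(ℝ, E) 𝓘(ℝ, E) (fun x : G => a * x * a⁻¹) 1 X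

/-- `Ad(G)`-invariant Euclidean inner products on the Lie algebra of `G`. -/
structure AdInvariantInnerProduct where
  form : LinearMap.BilinForm ℝ (GroupLieAlgebra 𝓘(ℝ, E) G)
  symm : ∀ X Y, form X Y = form Y X
  pos : ∀ X, X ≠ 0 → 0 < form X X
  ad_invariant : ∀ (a : G) (X Y : GroupLieAlgebra 𝓘(ℝ, E) G),
    form (adjointAction a X) (adjointAction a Y) = form X Y

end LieAlgebra

/-! ### Homogeneous spaces -/

section Homogeneous

variable {E : Type*} [NormedAddCommGroup E] [NormedSpace ℝ E] [FiniteDimensional ℝ E]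
  {G : Type*} [TopologicalSpace G] [ChartedSpace E G] [Group G]
  (H : Subgroup G)
  {F : Type*} [NormedAddCommGroup F] [NormedSpace ℝ F]
  [ChartedSpace F (G ⧸ H)]

variable (E F) in
/-- The manifold structure given on `G ⧸ H` is the quotient structure: the projection
`G → G ⧸ H` is a smooth submersion. (This determines the smooth structure uniquely.) -/
def IsHomogeneousSpace : Prop :=
  IsSubmersion 𝓘(ℝ, E) 𝓘(ℝ, F) ∞ (fun a : G => (a : G ⧸ H))

variable (E F) in
/-- The differential at `1` of the projection `G → G ⧸ H`, from the Lie algebra of `G` to the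
tangent space of `G ⧸ H` at the base point `eH`. -/
def evalBase : GroupLieAlgebra 𝓘(ℝ, E) G →L[ℝ] TangentSpace 𝓘(ℝ, F) ((1 : G) : G ⧸ H) :=
  mfderiv 𝓘(ℝ, E) 𝓘(ℝ, F) (fun a : G => (a : G ⧸ H)) 1

variable (E F) in
/-- The Lie algebra of the closed subgroup `H`, that is, its tangent space at `1`. As `H` is the
fibre over `eH` of the submersion `G → G ⧸ H`, this is the kernel of the differential. -/
def isotropyAlgebra : Submodule ℝ (GroupLieAlgebra 𝓘(ℝ, E) G) :=
  LinearMap.ker (evalBase E H F).toLinearMap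

variable (Q : AdInvariantInnerProduct (E := E) G)

variable (F) in
/-- The `Q`-orthogonal complement `𝔪` of the isotropy algebra `𝔥`. -/
def complementSpace : Submodule ℝ (GroupLieAlgebra 𝓘(ℝ, E) G) :=
  Q.form.orthogonal (isotropyAlgebra E H F)

/-- `Q` being definite, the Lie algebra is the direct sum of `𝔥` and `𝔪`. -/
theorem isCompl_isotropy_complement :
    IsCompl (isotropyAlgebra E H F) (complementSpace H F Q) := by
  have : FiniteDimensional ℝ (GroupLieAlgebra 𝓘(ℝ, E) G) := inferInstanceAs (FiniteDimensional ℝ E)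
  have hrefl : Q.form.IsRefl := fun X Y h => by rw [Q.symm]; exact h
  refine (LinearMap.BilinForm.isCompl_orthogonal_iff_disjoint hrefl).2 ?_
  rw [Submodule.disjoint_def]
  intro X hX hX'
  by_contra hne
  exact (Q.pos X hne).ne' (hX' X hX)

variable (F) in
/-- The `Q`-orthogonal projection of the Lie algebra onto `𝔥`. -/
def projIsotropy : GroupLieAlgebra 𝓘(ℝ, E) G →ₗ[ℝ] GroupLieAlgebra 𝓘(ℝ, E) G :=
  Submodule.projection _ _ (isCompl_isotropy_complement H (F := F) Q)

variable (F) in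
/-- The `Q`-orthogonal projection of the Lie algebra onto `𝔪`. -/
def projComplement : GroupLieAlgebra 𝓘(ℝ, E) G →ₗ[ℝ] GroupLieAlgebra 𝓘(ℝ, E) G :=
  Submodule.projection _ _ (isCompl_isotropy_complement H (F := F) Q).symm

variable {H} [FiniteDimensional ℝ F] [IsManifold 𝓘(ℝ, F) ∞ (G ⧸ H)]

/-- `g` is invariant under all left translations `x ↦ a • x` of `G ⧸ H`. -/
def IsInvariantMetric (g : SmoothMetric F (G ⧸ H)) : Prop :=
  ∀ (a : G) (x : G ⧸ H) (u v : TangentSpace 𝓘(ℝ, F) x),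
    g.inner (a • x) (mfderiv 𝓘(ℝ, F) 𝓘(ℝ, F) (fun y : G ⧸ H => a • y) x u)
      (mfderiv 𝓘(ℝ, F) 𝓘(ℝ, F) (fun y : G ⧸ H => a • y) x v) = g.inner x u v

/-- The value of `g` at the base point `eH`, as a form on the Lie algebra of `G`; its restriction
to `𝔪` is the inner product on `𝔪 ≅ T_{eH}(G ⧸ H)` that corresponds to `g`. -/
def metricAtBase (g : SmoothMetric F (G ⧸ H)) (X Y : GroupLieAlgebra 𝓘(ℝ, E) G) : ℝ :=
  g.inner ((1 : G) : G ⧸ H) (evalBase E H F X) (evalBase E H F Y)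

/-- The eigenvalues of `g` with respect to `Q`: those of the `Q`-symmetric endomorphism `A` of
`𝔪` with `g = Q(A ·, ·)` on `𝔪`. -/
def metricEigenvalues (g : SmoothMetric F (G ⧸ H)) : Set ℝ :=
  {l | ∃ X ∈ complementSpace H F Q, X ≠ 0 ∧
    ∀ Y ∈ complementSpace H F Q, metricAtBase g X Y = l * Q.form X Y}

/-- The sequence is normalized with respect to the most shrinking direction: the smallest
eigenvalue of every `g⁽ⁿ⁾` is `1`. -/
def IsNormalizedMostShrinking (g : ℕ → SmoothMetric F (G ⧸ H)) : Prop :=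
  ∀ n, IsLeast (metricEigenvalues Q (g n)) 1

/-- `b` is a basis of `𝔪` that is orthonormal for `g`. -/
def IsMetricOrthonormal (g : SmoothMetric F (G ⧸ H)) {ι : Type*} [DecidableEq ι]
    (b : Module.Basis ι ℝ (complementSpace H F Q)) : Prop :=
  ∀ i j, metricAtBase g (b i : GroupLieAlgebra 𝓘(ℝ, E) G) (b j) = if i = j then 1 else 0

/-- `|μ_𝔥|²` for the component `μ_𝔥 : 𝔪 ∧ 𝔪 → 𝔥` of the bracket, computed in a `g`-orthonormal
basis `b` of `𝔪`, with the norm of `Q` on `𝔥`. -/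
def bracketIsotropyNormSq {ι : Type*} [Fintype ι]
    (b : Module.Basis ι ℝ (complementSpace H F Q)) : ℝ :=
  ∑ i, ∑ j,
    let Z := projIsotropy H F Q
      ⁅(b i : GroupLieAlgebra 𝓘(ℝ, E) G), (b j : GroupLieAlgebra 𝓘(ℝ, E) G)⁆
    Q.form Z Z

/-- `|μ_𝔪|²` for the component `μ_𝔪 : 𝔪 ∧ 𝔪 → 𝔪` of the bracket, computed in a `g`-orthonormal
basis `b` of `𝔪`, with the norm of `g` on `𝔪`. -/
def bracketComplementNormSq (g : SmoothMetric F (G ⧸ H)) {ι : Type*} [Fintype ι]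
    (b : Module.Basis ι ℝ (complementSpace H F Q)) : ℝ :=
  ∑ i, ∑ j,
    let W := projComplement H F Q
      ⁅(b i : GroupLieAlgebra 𝓘(ℝ, E) G), (b j : GroupLieAlgebra 𝓘(ℝ, E) G)⁆
    metricAtBase g W W

/-- The sequence is algebraically non-collapsed: `|μ_𝔥|² + |μ_𝔪|² < C` along it, the norms being
those of `Q|_𝔥 + g⁽ⁿ⁾` (they do not depend on the `g⁽ⁿ⁾`-orthonormal basis of `𝔪`). -/
def IsAlgebraicallyNonCollapsed (g : ℕ → SmoothMetric F (G ⧸ H)) : Prop :=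
  ∃ C : ℝ, 0 < C ∧ ∀ (n : ℕ)
    (b : Module.Basis (Fin (Module.finrank ℝ (complementSpace H F Q))) ℝ (complementSpace H F Q)),
    IsMetricOrthonormal Q (g n) b →
      bracketIsotropyNormSq Q b + bracketComplementNormSq Q (g n) b < C

end Homogeneous

end

/-! Only $\mu_{\mathfrak m}$ needs curvature. The normalization says $Q\le g$ on $\mathfrak m$, so a
$g$-orthonormal basis $(f_i)$ has $Q(f_i,f_i)\le 1$. The bracket of $\mathfrak g$ is bounded for
$Q$, say $|[x,y]|_Q^2\le\kappa|x|_Q^2|y|_Q^2$, and this already bounds $|\mu_{\mathfrak h}|^2$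
(`bracket_norm_bound`).

For $\mu_{\mathfrak m}$ put $c_{ijk}=g([f_i,f_j]_{\mathfrak m},f_k)$. Fundamental fields of the
action are Killing, so at $eH$ the curvature of the plane of $f_i,f_j$ is a polynomial in the
$c_{ijk}$ plus the term $-g([f_i,[f_i,f_j]]_{\mathfrak m},f_j)$ (`IsKillingFamily.inner_curvature`,
`abs_structure_constants_le`). Summing over all $i,j$ gives the scalar curvature $$-\tfrac14\sum
c_{ijk}^2+\tfrac12\sum c_{ijk}c_{ikj}-\sum_{i,j} g([f_i,[f_i,f_j]]_{\mathfrak m},f_j).$$ The last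
two sums are made of traces of endomorphisms of $\mathfrak m$, hence may be computed in a
$Q$-orthonormal basis, where $\mathrm{ad}$ is skew: the second sum is $\le 0$, and the third
contributes at most a constant multiple of $\kappa$. Since the scalar curvature is bounded below,
$|\mu_{\mathfrak m}|_g^2=\sum c_{ijk}^2$ is bounded (`sum_bracket_estimate`).

The fundamental fields are obtained by pushing left invariant fields of $G$ forward along $a\mapsto
a^{-1}H$, so that brackets carry over without a sign. That they are Killing for an invariant metric
reduces to $d\,\mathrm{Ad}=\mathrm{ad}$ (`mfderiv_adjointOrbit`), proved by computing in a chart at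
the unit. -/

noncomputable section

/-! ### Vector fields in charts, and brackets of related vector fields -/

section ChartFields

open VectorField Set Filter
open scoped Topology

variable {E : Type*} [NormedAddCommGroup E] [NormedSpace ℝ E]
  {M : Type*} [TopologicalSpace M] [ChartedSpace E M]
  {E' : Type*} [NormedAddCommGroup E'] [NormedSpace ℝ E']
  {M' : Type*} [TopologicalSpace M'] [ChartedSpace E' M']

/-- The expression of the vector field `V` in the preferred chart at `x₀`. -/
def chartField (V : Π x : M, TangentSpace 𝓘(ℝ, E) x) (x₀ : M) (u : E) : E :=
  mfderiv 𝓘(ℝ, E) 𝓘(ℝ, E) (extChartAt 𝓘(ℝ, E) x₀) ((extChartAt 𝓘(ℝ, E) x₀).symm u)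
    (V ((extChartAt 𝓘(ℝ, E) x₀).symm u))

theorem chartField_eq_mpullbackWithin [IsManifold 𝓘(ℝ, E) 1 M]
    (V : Π x : M, TangentSpace 𝓘(ℝ, E) x) (x₀ : M) {u : E}
    (hu : u ∈ (extChartAt 𝓘(ℝ, E) x₀).target) :
    mpullbackWithin 𝓘(ℝ, E) 𝓘(ℝ, E) (extChartAt 𝓘(ℝ, E) x₀).symm V (range 𝓘(ℝ, E)) u =
      chartField V x₀ u := by
  have h := ContinuousLinearMap.inverse_eq
    (mfderivWithin_extChartAt_symm_comp_mfderiv_extChartAt (I := 𝓘(ℝ, E)) hu)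
    (mfderiv_extChartAt_comp_mfderivWithin_extChartAt_symm (I := 𝓘(ℝ, E)) hu)
  rw [mpullbackWithin_apply, h]
  rfl

theorem chartField_eventuallyEq [IsManifold 𝓘(ℝ, E) 1 M]
    (V : Π x : M, TangentSpace 𝓘(ℝ, E) x) (x₀ : M) :
    (mpullbackWithin 𝓘(ℝ, E) 𝓘(ℝ, E) (extChartAt 𝓘(ℝ, E) x₀).symm V (range 𝓘(ℝ, E)) : E → E)
      =ᶠ[𝓝 (extChartAt 𝓘(ℝ, E) x₀ x₀)] chartField V x₀ := by
  filter_upwards [extChartAt_target_mem_nhds (I := 𝓘(ℝ, E)) x₀] with u hu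
  exact chartField_eq_mpullbackWithin V x₀ hu

theorem differentiableAt_chartField [CompleteSpace E] [IsManifold 𝓘(ℝ, E) 2 M]
    {V : Π x : M, TangentSpace 𝓘(ℝ, E) x} {x₀ : M} (hV : MDiffAt (T% V) x₀) :
    DifferentiableAt ℝ (chartField V x₀) (extChartAt 𝓘(ℝ, E) x₀ x₀) := by
  have : IsManifold 𝓘(ℝ, E) 1 M := IsManifold.of_le (n := 2) (by norm_num)
  rw [← mdifferentiableWithinAt_univ] at hV
  have h := hV.differentiableWithinAt_mpullbackWithin_vectorField
  simp only [preimage_univ, univ_inter, modelWithCornersSelf_coe, range_id] at h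
  refine (differentiableWithinAt_univ.1 h).congr_of_eventuallyEq ?_
  have h' := (chartField_eventuallyEq V x₀).symm
  simpa only [modelWithCornersSelf_coe, range_id] using h'

/-- The bracket on a manifold is the chart bracket transported back by the differential of the
chart, and at its own centre the preferred chart has differential the identity. -/
theorem mlieBracket_eq_lieBracket_chartField [IsManifold 𝓘(ℝ, E) 1 M]
    (V W : Π x : M, TangentSpace 𝓘(ℝ, E) x) (x₀ : M) :
    (mlieBracket 𝓘(ℝ, E) V W x₀ : E) =
      lieBracket ℝ (chartField V x₀) (chartField W x₀) (extChartAt 𝓘(ℝ, E) x₀ x₀) := by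
  have hid : (mfderiv 𝓘(ℝ, E) 𝓘(ℝ, E) (extChartAt 𝓘(ℝ, E) x₀) x₀).inverse =
      ContinuousLinearMap.id ℝ E :=
    (congrArg (ContinuousLinearMap.inverse (M := E) (M₂ := E))
      (mfderiv_extChartAt_self (I := 𝓘(ℝ, E)) (x := x₀))).trans ContinuousLinearMap.inverse_id
  rw [← mlieBracketWithin_univ, mlieBracketWithin_apply, hid]
  have hr : range 𝓘(ℝ, E) = univ := by simp
  have h1 := (chartField_eventuallyEq V x₀)
  have h2 := (chartField_eventuallyEq W x₀)
  have h3 := Filter.EventuallyEq.lieBracket_vectorField_eq (𝕜 := ℝ) h1 h2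
  have hset : ((extChartAt 𝓘(ℝ, E) x₀).symm ⁻¹' univ ∩ range 𝓘(ℝ, E) : Set E) = univ := by
    rw [hr, preimage_univ, univ_inter]
  rw [← h3, hset]
  exact congrFun (lieBracketWithin_univ (𝕜 := ℝ) (E := E)) _

/-- If vector fields on `M` are related through `f` to vector fields on `M'`, so are their
brackets. -/
theorem mfderiv_mlieBracket_of_related [CompleteSpace E] [CompleteSpace E']
    [IsManifold 𝓘(ℝ, E) 2 M] [IsManifold 𝓘(ℝ, E') 2 M'] {f : M → M'} {x : M}
    (hf : ContMDiffAt 𝓘(ℝ, E) 𝓘(ℝ, E') 2 f x)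
    {V W : Π x : M, TangentSpace 𝓘(ℝ, E) x} {V' W' : Π x : M', TangentSpace 𝓘(ℝ, E') x}
    (hV : MDiffAt (T% V) x) (hW : MDiffAt (T% W) x)
    (hV' : MDiffAt (T% V') (f x)) (hW' : MDiffAt (T% W') (f x))
    (hVV' : ∀ᶠ y in 𝓝 x, mfderiv 𝓘(ℝ, E) 𝓘(ℝ, E') f y (V y) = V' (f y))
    (hWW' : ∀ᶠ y in 𝓝 x, mfderiv 𝓘(ℝ, E) 𝓘(ℝ, E') f y (W y) = W' (f y)) :
    mfderiv 𝓘(ℝ, E) 𝓘(ℝ, E') f x (mlieBracket 𝓘(ℝ, E) V W x) =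
      mlieBracket 𝓘(ℝ, E') V' W' (f x) := by
  have : IsManifold 𝓘(ℝ, E) 1 M := IsManifold.of_le (n := 2) (by norm_num)
  have : IsManifold 𝓘(ℝ, E') 1 M' := IsManifold.of_le (n := 2) (by norm_num)
  set φ := extChartAt 𝓘(ℝ, E) x with hφ
  set ψ := extChartAt 𝓘(ℝ, E') (f x) with hψ
  set F : E → E' := ψ ∘ f ∘ φ.symm with hF
  have hxx : φ.symm (φ x) = x := extChartAt_to_inv x
  have hFx : F (φ x) = ψ (f x) := by simp only [hF, Function.comp, hxx]
  have hFd : ContDiffAt ℝ 2 F (φ x) := by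
    have := (contMDiffAt_iff.1 hf).2
    simp only [modelWithCornersSelf_coe, range_id] at this
    exact contDiffWithinAt_univ.1 this
  have hmd : ∀ᶠ y in 𝓝 x, MDifferentiableAt 𝓘(ℝ, E) 𝓘(ℝ, E') f y := by
    obtain ⟨u, hu, hfu⟩ := (contMDiffAt_iff_contMDiffOn_nhds (n := 2) (by simp)).1 hf
    filter_upwards [eventually_mem_nhds_iff.2 hu] with y hy
    exact (hfu.contMDiffAt hy).mdifferentiableAt (by norm_num)
  have hcont : Tendsto φ.symm (𝓝 (φ x)) (𝓝 x) := by
    have := continuousAt_extChartAt_symm (I := 𝓘(ℝ, E)) x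
    rw [ContinuousAt, hxx] at this
    exact this
  have hsrc : ∀ᶠ y in 𝓝 x, f y ∈ ψ.source :=
    hf.continuousAt.eventually (extChartAt_source_mem_nhds (I := 𝓘(ℝ, E')) (f x))
  -- Relatedness through `f` becomes relatedness through the local representative `F`, by the chain
  -- rule applied to `F ∘ φ = ψ ∘ f`.
  have hrel : ∀ (V : Π x : M, TangentSpace 𝓘(ℝ, E) x) (V' : Π x : M', TangentSpace 𝓘(ℝ, E') x),
      (∀ᶠ y in 𝓝 x, mfderiv 𝓘(ℝ, E) 𝓘(ℝ, E') f y (V y) = V' (f y)) →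
      ∀ᶠ u in 𝓝 (φ x), fderiv ℝ F u (chartField V x u) = chartField V' (f x) (F u) := by
    intro V V' h
    filter_upwards [hcont.eventually h, hcont.eventually hmd, hcont.eventually hsrc,
      extChartAt_target_mem_nhds (I := 𝓘(ℝ, E)) x] with u h1 h2 h3 hu
    have hu' : φ.symm u ∈ (chartAt E x).source := by
      have := φ.map_target hu
      rwa [hφ, extChartAt_source] at this
    have h3' : f (φ.symm u) ∈ (chartAt E' (f x)).source := by
      rwa [hψ, extChartAt_source] at h3
    have hFφ : HasFDerivAt F (fderiv ℝ F u) u := by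
      refine DifferentiableAt.hasFDerivAt ?_
      rw [← mdifferentiableAt_iff_differentiableAt]
      refine (mdifferentiableAt_extChartAt h3').comp u (h2.comp u ?_)
      have := mdifferentiableWithinAt_extChartAt_symm (I := 𝓘(ℝ, E)) hu
      simp only [modelWithCornersSelf_coe, range_id] at this
      exact mdifferentiableWithinAt_univ.1 this
    have e1 : HasMFDerivAt 𝓘(ℝ, E) 𝓘(ℝ, E') (F ∘ φ) (φ.symm u)
        ((fderiv ℝ F u).comp (mfderiv 𝓘(ℝ, E) 𝓘(ℝ, E) φ (φ.symm u))) := by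
      have a : HasMFDerivAt 𝓘(ℝ, E) 𝓘(ℝ, E') F (φ (φ.symm u)) (fderiv ℝ F u) := by
        rw [φ.right_inv hu]
        exact hFφ.hasMFDerivAt
      exact a.comp _ (mdifferentiableAt_extChartAt hu').hasMFDerivAt
    have e2 : HasMFDerivAt 𝓘(ℝ, E) 𝓘(ℝ, E') (ψ ∘ f) (φ.symm u)
        ((mfderiv 𝓘(ℝ, E') 𝓘(ℝ, E') ψ (f (φ.symm u))).comp
          (mfderiv 𝓘(ℝ, E) 𝓘(ℝ, E') f (φ.symm u))) :=
      (mdifferentiableAt_extChartAt h3').hasMFDerivAt.comp _ h2.hasMFDerivAt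
    have e3 : (F ∘ φ) =ᶠ[𝓝 (φ.symm u)] (ψ ∘ f) := by
      filter_upwards [(isOpen_extChartAt_source (I := 𝓘(ℝ, E)) x).mem_nhds (φ.map_target hu)]
        with y hy
      simp only [hF, Function.comp, φ.left_inv hy]
    have e4 := hasMFDerivAt_unique e1 (e2.congr_of_eventuallyEq e3)
    have e5 := congrArg (fun L => L (V (φ.symm u))) e4
    refine Eq.trans e5 ?_
    have e6 : F u = ψ (f (φ.symm u)) := rfl
    simp only [chartField]
    -- The point is generalized because `V'` takes values in a fibre depending on it, which blocks
    -- direct rewriting.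
    have key : ∀ q : M', q = f (φ.symm u) →
      (mfderiv 𝓘(ℝ, E') 𝓘(ℝ, E') ψ (f (φ.symm u))) (V' (f (φ.symm u))) =
      (mfderiv 𝓘(ℝ, E') 𝓘(ℝ, E') ψ q (V' q) : E') := by rintro q rfl; rfl
    rw [← key (ψ.symm (F u)) (by rw [e6, ψ.left_inv h3])]
    exact congrArg (mfderiv 𝓘(ℝ, E') 𝓘(ℝ, E') ψ (f (φ.symm u))) h1
  have r1 := hrel V V' hVV'
  have r2 := hrel W W' hWW'
  have dV := differentiableAt_chartField hV
  have dW := differentiableAt_chartField hW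
  have dV' := differentiableAt_chartField hV'
  have dW' := differentiableAt_chartField hW'
  rw [← hψ, ← hFx] at dV' dW'
  -- In the model space, symmetry of the second derivative of `F` leaves only derivatives of the
  -- pushed-forward fields.
  have main := fderiv_apply_lieBracket hFd (by simp) dW dV
  have c : ∀ (V : Π x : M, TangentSpace 𝓘(ℝ, E) x) (W : Π x : M, TangentSpace 𝓘(ℝ, E) x)
      (V' : Π x : M', TangentSpace 𝓘(ℝ, E') x) (W' : Π x : M', TangentSpace 𝓘(ℝ, E') x),
      (∀ᶠ u in 𝓝 (φ x), fderiv ℝ F u (chartField V x u) = chartField V' (f x) (F u)) →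
      (∀ᶠ u in 𝓝 (φ x), fderiv ℝ F u (chartField W x u) = chartField W' (f x) (F u)) →
      DifferentiableAt ℝ (chartField W' (f x)) (F (φ x)) →
      fderiv ℝ (fun u => fderiv ℝ F u (chartField W x u)) (φ x) (chartField V x (φ x)) =
        fderiv ℝ (chartField W' (f x)) (F (φ x)) (chartField V' (f x) (F (φ x))) := by
    intro V W V' W' hv hw hd
    rw [Filter.EventuallyEq.fderiv_eq hw]
    have := fderiv_comp (φ x) hd (hFd.differentiableAt (by norm_num))
    have e : (fun u => chartField W' (f x) (F u)) = chartField W' (f x) ∘ F := rfl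
    rw [e, this, ContinuousLinearMap.comp_apply, hv.self_of_nhds]
  rw [c V W V' W' r1 r2 dW', c W V W' V' r2 r1 dV'] at main
  have hfd : ∀ v : E, (mfderiv 𝓘(ℝ, E) 𝓘(ℝ, E') f x (v : TangentSpace 𝓘(ℝ, E) x) : E') =
      fderiv ℝ F (φ x) v := by
    intro v
    rw [(hf.mdifferentiableAt (by norm_num)).mfderiv]
    simp only [writtenInExtChartAt, modelWithCornersSelf_coe, range_id, fderivWithin_univ]
    rfl
  refine (hfd _).trans ?_
  rw [mlieBracket_eq_lieBracket_chartField, mlieBracket_eq_lieBracket_chartField, main, ← hψ, ← hFx]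
  rfl

end ChartFields

/-! ### The differential of the adjoint representation -/

section Adjoint

open VectorField Set Filter
open scoped Topology

variable {E : Type*} [NormedAddCommGroup E] [NormedSpace ℝ E]
  {G : Type*} [TopologicalSpace G] [ChartedSpace E G] [Group G]

theorem mfderiv_apply_eq_fderiv_comp_extChartAt_symm {M : Type*} [TopologicalSpace M]
    [ChartedSpace E M] {E' : Type*} [NormedAddCommGroup E'] [NormedSpace ℝ E'] {h : M → E'} {x : M}
    (hh : MDifferentiableAt 𝓘(ℝ, E) 𝓘(ℝ, E') h x) (Y : TangentSpace 𝓘(ℝ, E) x) :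
    (mfderiv 𝓘(ℝ, E) 𝓘(ℝ, E') h x Y : E') =
      fderiv ℝ (h ∘ (extChartAt 𝓘(ℝ, E) x).symm) (extChartAt 𝓘(ℝ, E) x x) Y := by
  rw [hh.mfderiv]
  simp only [writtenInExtChartAt, modelWithCornersSelf_coe, range_id, fderivWithin_univ]
  rfl

variable (E G) in
/-- The multiplication of `G` in the preferred chart at `1`. -/
def chartMul (p : E × E) : E :=
  extChartAt 𝓘(ℝ, E) (1 : G)
    ((extChartAt 𝓘(ℝ, E) (1 : G)).symm p.1 * (extChartAt 𝓘(ℝ, E) (1 : G)).symm p.2)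

variable (E G) in
/-- Conjugation in `G`, in the preferred chart at `1`. -/
def chartConj (p : E × E) : E :=
  extChartAt 𝓘(ℝ, E) (1 : G)
    ((extChartAt 𝓘(ℝ, E) (1 : G)).symm p.1 * (extChartAt 𝓘(ℝ, E) (1 : G)).symm p.2 *
      ((extChartAt 𝓘(ℝ, E) (1 : G)).symm p.1)⁻¹)

variable (E G) in
/-- The coordinates of `1` in its preferred chart. -/
def chartOne : E := extChartAt 𝓘(ℝ, E) (1 : G) 1

theorem extChartAt_symm_chartOne : (extChartAt 𝓘(ℝ, E) (1 : G)).symm (chartOne E G) = 1 :=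
  extChartAt_to_inv (I := 𝓘(ℝ, E)) (1 : G)

theorem chartOne_mem_target : chartOne E G ∈ (extChartAt 𝓘(ℝ, E) (1 : G)).target :=
  mem_extChartAt_target (I := 𝓘(ℝ, E)) (1 : G)

theorem tendsto_mk_chartOne :
    Tendsto (fun u : E => (u, chartOne E G)) (𝓝 (chartOne E G)) (𝓝 (chartOne E G, chartOne E G)) :=
  (Continuous.prodMk_left (chartOne E G)).tendsto _

theorem tendsto_chartOne_mk :
    Tendsto (fun u : E => (chartOne E G, u)) (𝓝 (chartOne E G)) (𝓝 (chartOne E G, chartOne E G)) :=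
  (Continuous.prodMk_right (chartOne E G)).tendsto _

theorem chartConj_chartOne_right (u : E) : chartConj E G (u, chartOne E G) = chartOne E G := by
  simp only [chartConj, extChartAt_symm_chartOne, mul_one, mul_inv_cancel]
  rfl

variable [LieGroup 𝓘(ℝ, E) ∞ G]

theorem contMDiffAt_extChartAt_symm_one {u : E}
    (hu : u ∈ (extChartAt 𝓘(ℝ, E) (1 : G)).target) :
    ContMDiffAt 𝓘(ℝ, E) 𝓘(ℝ, E) ∞ (extChartAt 𝓘(ℝ, E) (1 : G)).symm u :=
  (contMDiffOn_extChartAt_symm (I := 𝓘(ℝ, E)) (n := ∞) (1 : G)).contMDiffAt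
    ((isOpen_extChartAt_target (I := 𝓘(ℝ, E)) (1 : G)).mem_nhds hu)

theorem contDiffAt_chartMul : ContDiffAt ℝ ∞ (chartMul E G) (chartOne E G, chartOne E G) := by
  rw [← contMDiffAt_iff_contDiffAt]
  have h1 : ContMDiffAt 𝓘(ℝ, E × E) 𝓘(ℝ, E) ∞
      (fun p : E × E => (extChartAt 𝓘(ℝ, E) (1 : G)).symm p.1) (chartOne E G, chartOne E G) :=
    (contMDiffAt_extChartAt_symm_one (G := G) chartOne_mem_target).comp
      ((chartOne E G, chartOne E G) : E × E) contDiff_fst.contMDiff.contMDiffAt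
  have h2 : ContMDiffAt 𝓘(ℝ, E × E) 𝓘(ℝ, E) ∞
      (fun p : E × E => (extChartAt 𝓘(ℝ, E) (1 : G)).symm p.2) (chartOne E G, chartOne E G) :=
    (contMDiffAt_extChartAt_symm_one (G := G) chartOne_mem_target).comp
      ((chartOne E G, chartOne E G) : E × E) contDiff_snd.contMDiff.contMDiffAt
  refine ContMDiffAt.comp (I' := 𝓘(ℝ, E)) (x := ((chartOne E G, chartOne E G) : E × E))
    (g := extChartAt 𝓘(ℝ, E) (1 : G)) (f := fun p : E × E =>
    (extChartAt 𝓘(ℝ, E) (1 : G)).symm p.1 * (extChartAt 𝓘(ℝ, E) (1 : G)).symm p.2) ?_ (h1.mul h2)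
  simp only [extChartAt_symm_chartOne, mul_one]
  exact contMDiffAt_extChartAt

theorem contDiffAt_chartConj : ContDiffAt ℝ ∞ (chartConj E G) (chartOne E G, chartOne E G) := by
  rw [← contMDiffAt_iff_contDiffAt]
  have h1 : ContMDiffAt 𝓘(ℝ, E × E) 𝓘(ℝ, E) ∞
      (fun p : E × E => (extChartAt 𝓘(ℝ, E) (1 : G)).symm p.1) (chartOne E G, chartOne E G) :=
    (contMDiffAt_extChartAt_symm_one (G := G) chartOne_mem_target).comp
      ((chartOne E G, chartOne E G) : E × E) contDiff_fst.contMDiff.contMDiffAt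
  have h2 : ContMDiffAt 𝓘(ℝ, E × E) 𝓘(ℝ, E) ∞
      (fun p : E × E => (extChartAt 𝓘(ℝ, E) (1 : G)).symm p.2) (chartOne E G, chartOne E G) :=
    (contMDiffAt_extChartAt_symm_one (G := G) chartOne_mem_target).comp
      ((chartOne E G, chartOne E G) : E × E) contDiff_snd.contMDiff.contMDiffAt
  refine ContMDiffAt.comp (I' := 𝓘(ℝ, E)) (x := ((chartOne E G, chartOne E G) : E × E))
    (g := extChartAt 𝓘(ℝ, E) (1 : G)) (f := fun p : E × E =>
    (extChartAt 𝓘(ℝ, E) (1 : G)).symm p.1 * (extChartAt 𝓘(ℝ, E) (1 : G)).symm p.2 *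
      ((extChartAt 𝓘(ℝ, E) (1 : G)).symm p.1)⁻¹) ?_ ((h1.mul h2).mul h1.inv)
  simp only [extChartAt_symm_chartOne, mul_one, inv_one]
  exact contMDiffAt_extChartAt

theorem mdifferentiable_leftMul (a : G) :
    MDifferentiable 𝓘(ℝ, E) 𝓘(ℝ, E) (fun x : G => a * x) :=
  (contMDiff_mul_left (I := 𝓘(ℝ, E)) (n := ∞) (a := a)).mdifferentiable (by simp)

theorem contMDiff_conj (a : G) :
    ContMDiff 𝓘(ℝ, E) 𝓘(ℝ, E) ∞ (fun x : G => a * x * a⁻¹) :=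
  (contMDiff_mul_left (I := 𝓘(ℝ, E)) (n := ∞) (a := a)).mul contMDiff_const

theorem mdifferentiable_conj (a : G) :
    MDifferentiable 𝓘(ℝ, E) 𝓘(ℝ, E) (fun x : G => a * x * a⁻¹) :=
  (contMDiff_conj a).mdifferentiable (by simp)

theorem eventually_differentiableAt_of_contDiffAt {E₁ E₂ : Type*} [NormedAddCommGroup E₁]
    [NormedSpace ℝ E₁] [NormedAddCommGroup E₂] [NormedSpace ℝ E₂] {f : E₁ → E₂} {x : E₁}
    (hf : ContDiffAt ℝ ∞ f x) : ∀ᶠ y in 𝓝 x, DifferentiableAt ℝ f y := by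
  have h : ContDiffAt ℝ 1 f x := hf.of_le (by exact_mod_cast le_top)
  filter_upwards [h.eventually (by simp)] with y hy using hy.differentiableAt (by simp)


theorem adjointAction_eq_mfderiv_extChartAt (a : G) (Y : GroupLieAlgebra 𝓘(ℝ, E) G) :
    (adjointAction a Y : E) =
      mfderiv 𝓘(ℝ, E) 𝓘(ℝ, E) (fun x : G => extChartAt 𝓘(ℝ, E) (1 : G) (a * x * a⁻¹)) 1 Y := by
  have h1 : a * 1 * a⁻¹ = 1 := by simp
  have hm : MDifferentiableAt 𝓘(ℝ, E) 𝓘(ℝ, E) (extChartAt 𝓘(ℝ, E) (1 : G)) (a * 1 * a⁻¹) := by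
    rw [h1]
    exact mdifferentiableAt_extChartAt (mem_chart_source E (1 : G))
  have h2 := mfderiv_comp (I := 𝓘(ℝ, E)) (I' := 𝓘(ℝ, E)) (I'' := 𝓘(ℝ, E)) (1 : G)
    (f := fun x : G => a * x * a⁻¹) (g := extChartAt 𝓘(ℝ, E) (1 : G)) hm (mdifferentiable_conj a 1)
  have h3 : (mfderiv 𝓘(ℝ, E) 𝓘(ℝ, E) (extChartAt 𝓘(ℝ, E) (1 : G)) (a * 1 * a⁻¹) : E →L[ℝ] E) =
      ContinuousLinearMap.id ℝ E :=
    (mfderiv_congr_point h1).trans mfderiv_extChartAt_self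
  have h4 := congrArg (fun L => L Y) h2
  refine Eq.trans ?_ h4.symm
  exact (congrArg (fun L : E →L[ℝ] E => L (adjointAction a Y : E)) h3).symm

theorem adjointAction_eq_fderiv_chartConj :
    ∀ᶠ u in 𝓝 (chartOne E G), ∀ Y : GroupLieAlgebra 𝓘(ℝ, E) G,
      (adjointAction ((extChartAt 𝓘(ℝ, E) (1 : G)).symm u) Y : E) =
        fderiv ℝ (chartConj E G) (u, chartOne E G) (0, Y) := by
  filter_upwards [tendsto_mk_chartOne.eventually
    (eventually_differentiableAt_of_contDiffAt (contDiffAt_chartConj (E := E) (G := G)))] with u hu Y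
  rw [adjointAction_eq_mfderiv_extChartAt]
  set a := (extChartAt 𝓘(ℝ, E) (1 : G)).symm u with ha
  have h1 : a * 1 * a⁻¹ = 1 := by simp
  have hm : MDifferentiableAt 𝓘(ℝ, E) 𝓘(ℝ, E) (extChartAt 𝓘(ℝ, E) (1 : G)) (a * 1 * a⁻¹) := by
    rw [h1]
    exact mdifferentiableAt_extChartAt (mem_chart_source E (1 : G))
  refine (mfderiv_apply_eq_fderiv_comp_extChartAt_symm
    (hm.comp (1 : G) (f := fun x : G => a * x * a⁻¹) (mdifferentiable_conj a 1)) Y).trans ?_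
  have h5 : HasFDerivAt (fun v : E => ((u, v) : E × E)) (ContinuousLinearMap.inr ℝ E E)
    (chartOne E G) := hasFDerivAt_prodMk_right u (chartOne E G)
  have h6 := (hu.hasFDerivAt.comp (chartOne E G) h5).fderiv
  refine (congrArg (fun L : E →L[ℝ] E => L Y) h6).trans ?_
  rfl

theorem chartField_mulInvariantVectorField :
    ∀ᶠ u in 𝓝 (chartOne E G), ∀ Y : GroupLieAlgebra 𝓘(ℝ, E) G,
      chartField (mulInvariantVectorField Y) (1 : G) u =
        fderiv ℝ (chartMul E G) (u, chartOne E G) (0, Y) := by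
  filter_upwards [tendsto_mk_chartOne.eventually
    (eventually_differentiableAt_of_contDiffAt (contDiffAt_chartMul (E := E) (G := G))),
    (isOpen_extChartAt_target (I := 𝓘(ℝ, E)) (1 : G)).mem_nhds chartOne_mem_target] with u hu hut Y
  set a := (extChartAt 𝓘(ℝ, E) (1 : G)).symm u with ha
  have hm : MDifferentiableAt 𝓘(ℝ, E) 𝓘(ℝ, E) (extChartAt 𝓘(ℝ, E) (1 : G)) (a * 1) := by
    rw [mul_one]
    refine mdifferentiableAt_extChartAt ?_
    rw [← extChartAt_source 𝓘(ℝ, E)]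
    exact (extChartAt 𝓘(ℝ, E) (1 : G)).map_target hut
  have hmc := hm.comp (1 : G) (f := fun x : G => a * x) (mdifferentiable_leftMul a 1)
  have h2 := mfderiv_comp (I := 𝓘(ℝ, E)) (I' := 𝓘(ℝ, E)) (I'' := 𝓘(ℝ, E)) (1 : G)
    (f := fun x : G => a * x) (g := extChartAt 𝓘(ℝ, E) (1 : G)) hm (mdifferentiable_leftMul a 1)
  have h3 : chartField (mulInvariantVectorField Y) (1 : G) u =
      mfderiv 𝓘(ℝ, E) 𝓘(ℝ, E) (extChartAt 𝓘(ℝ, E) (1 : G) ∘ fun x : G => a * x) 1 Y := by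
    refine Eq.trans ?_ (congrArg (fun L => L Y) h2).symm
    have h4 : (mfderiv 𝓘(ℝ, E) 𝓘(ℝ, E) (extChartAt 𝓘(ℝ, E) (1 : G)) (a * 1) : E →L[ℝ] E) =
      mfderiv 𝓘(ℝ, E) 𝓘(ℝ, E) (extChartAt 𝓘(ℝ, E) (1 : G)) a := mfderiv_congr_point (mul_one a)
    exact (congrArg (fun L : E →L[ℝ] E => L (mulInvariantVectorField Y a : E)) h4).symm
  rw [h3, mfderiv_apply_eq_fderiv_comp_extChartAt_symm hmc]
  have h5 : HasFDerivAt (fun v : E => ((u, v) : E × E)) (ContinuousLinearMap.inr ℝ E E)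
    (chartOne E G) := hasFDerivAt_prodMk_right u (chartOne E G)
  have h6 := (hu.hasFDerivAt.comp (chartOne E G) h5).fderiv
  refine (congrArg (fun L : E →L[ℝ] E => L Y) h6).trans ?_
  rfl

theorem fderiv_chartMul_left (w : E) :
    fderiv ℝ (chartMul E G) (chartOne E G, chartOne E G) (w, 0) = w := by
  have hd := (contDiffAt_chartMul (E := E) (G := G)).differentiableAt (by simp)
  have h5 : HasFDerivAt (fun v : E => ((v, chartOne E G) : E × E)) (ContinuousLinearMap.inl ℝ E E)
    (chartOne E G) := hasFDerivAt_prodMk_left _ _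
  have h6 := HasFDerivAt.comp (g := chartMul E G)
    (f := fun v : E => ((v, chartOne E G) : E × E)) (chartOne E G) hd.hasFDerivAt h5
  have h7 : (chartMul E G ∘ fun v : E => ((v, chartOne E G) : E × E)) =ᶠ[𝓝 (chartOne E G)] id := by
    filter_upwards [(isOpen_extChartAt_target (I := 𝓘(ℝ, E)) (1 : G)).mem_nhds chartOne_mem_target]
      with u hu
    simp only [Function.comp, chartMul, extChartAt_symm_chartOne, mul_one, id]
    exact (extChartAt 𝓘(ℝ, E) (1 : G)).right_inv hu
  have h8 := (h6.congr_of_eventuallyEq h7.symm).unique (hasFDerivAt_id _)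
  exact congrArg (fun L : E →L[ℝ] E => L w) h8

theorem fderiv_chartMul_right (w : E) :
    fderiv ℝ (chartMul E G) (chartOne E G, chartOne E G) (0, w) = w := by
  have hd := (contDiffAt_chartMul (E := E) (G := G)).differentiableAt (by simp)
  have h5 : HasFDerivAt (fun v : E => ((chartOne E G, v) : E × E)) (ContinuousLinearMap.inr ℝ E E)
    (chartOne E G) := hasFDerivAt_prodMk_right _ _
  have h6 := HasFDerivAt.comp (g := chartMul E G) (chartOne E G) hd.hasFDerivAt h5
  have h7 : (chartMul E G ∘ fun v : E => ((chartOne E G, v) : E × E)) =ᶠ[𝓝 (chartOne E G)] id := by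
    filter_upwards [(isOpen_extChartAt_target (I := 𝓘(ℝ, E)) (1 : G)).mem_nhds chartOne_mem_target]
      with u hu
    simp only [Function.comp, chartMul, extChartAt_symm_chartOne, one_mul, id]
    exact (extChartAt 𝓘(ℝ, E) (1 : G)).right_inv hu
  have h8 := (h6.congr_of_eventuallyEq h7.symm).unique (hasFDerivAt_id _)
  exact congrArg (fun L : E →L[ℝ] E => L w) h8

/-- The identity $(uvu^{-1})u=uv$ lets derivatives of conjugation be read off from those of
multiplication, with no derivative of the inverse. -/
theorem chartMul_chartConj :
    ∀ᶠ p in 𝓝 ((chartOne E G, chartOne E G) : E × E),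
      chartMul E G (chartConj E G p, p.1) = chartMul E G p := by
  have h1 : ContinuousAt (fun p : E × E => (extChartAt 𝓘(ℝ, E) (1 : G)).symm p.1)
      (chartOne E G, chartOne E G) :=
    ContinuousAt.comp (x := ((chartOne E G, chartOne E G) : E × E))
      (g := (extChartAt 𝓘(ℝ, E) (1 : G)).symm)
      (continuousAt_extChartAt_symm (I := 𝓘(ℝ, E)) (1 : G)) continuousAt_fst
  have h2 : ContinuousAt (fun p : E × E => (extChartAt 𝓘(ℝ, E) (1 : G)).symm p.2)
      (chartOne E G, chartOne E G) :=
    ContinuousAt.comp (x := ((chartOne E G, chartOne E G) : E × E))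
      (g := (extChartAt 𝓘(ℝ, E) (1 : G)).symm)
      (continuousAt_extChartAt_symm (I := 𝓘(ℝ, E)) (1 : G)) continuousAt_snd
  have : IsTopologicalGroup G := topologicalGroup_of_lieGroup 𝓘(ℝ, E) ∞
  have h3 : ContinuousAt (fun p : E × E => (extChartAt 𝓘(ℝ, E) (1 : G)).symm p.1 *
      (extChartAt 𝓘(ℝ, E) (1 : G)).symm p.2 * ((extChartAt 𝓘(ℝ, E) (1 : G)).symm p.1)⁻¹)
      (chartOne E G, chartOne E G) := (h1.mul h2).mul h1.inv
  have h4 := h3.preimage_mem_nhds (t := (extChartAt 𝓘(ℝ, E) (1 : G)).source)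
    (by
      simp only [extChartAt_symm_chartOne, mul_one, inv_one]
      exact extChartAt_source_mem_nhds (I := 𝓘(ℝ, E)) (1 : G))
  filter_upwards [h4] with p hp
  simp only [chartMul, chartConj]
  rw [(extChartAt 𝓘(ℝ, E) (1 : G)).left_inv hp]
  simp only [inv_mul_cancel_right]

theorem fderiv_chartConj_chartOne (Y : E) :
    fderiv ℝ (chartConj E G) (chartOne E G, chartOne E G) (0, Y) = Y := by
  have hd := (contDiffAt_chartConj (E := E) (G := G)).differentiableAt (by simp)
  have h5 : HasFDerivAt (fun v : E => ((chartOne E G, v) : E × E)) (ContinuousLinearMap.inr ℝ E E)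
    (chartOne E G) := hasFDerivAt_prodMk_right _ _
  have h6 := HasFDerivAt.comp (g := chartConj E G) (chartOne E G) hd.hasFDerivAt h5
  have h7 : (chartConj E G ∘ fun v : E => ((chartOne E G, v) : E × E))
      =ᶠ[𝓝 (chartOne E G)] id := by
    filter_upwards [(isOpen_extChartAt_target (I := 𝓘(ℝ, E)) (1 : G)).mem_nhds chartOne_mem_target]
      with u hu
    simp only [Function.comp, chartConj, extChartAt_symm_chartOne, one_mul, inv_one, mul_one, id]
    exact (extChartAt 𝓘(ℝ, E) (1 : G)).right_inv hu
  have h8 := (h6.congr_of_eventuallyEq h7.symm).unique (hasFDerivAt_id _)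
  exact congrArg (fun L : E →L[ℝ] E => L Y) h8

/-- Differentiating $(uvu^{-1})u=uv$ in $v$ at the unit: the left translate of $Y$ by $u$ is the
right translate of $\mathrm{Ad}(u)Y$. -/
theorem fderiv_chartMul_fderiv_chartConj :
    ∀ᶠ u in 𝓝 (chartOne E G), ∀ Y : E,
      fderiv ℝ (chartMul E G) (chartOne E G, u)
        (fderiv ℝ (chartConj E G) (u, chartOne E G) (0, Y), 0) =
      fderiv ℝ (chartMul E G) (u, chartOne E G) (0, Y) := by
  filter_upwards [tendsto_mk_chartOne.eventually
      (eventually_differentiableAt_of_contDiffAt (contDiffAt_chartMul (E := E) (G := G))),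
    tendsto_chartOne_mk.eventually
      (eventually_differentiableAt_of_contDiffAt (contDiffAt_chartMul (E := E) (G := G))),
    tendsto_mk_chartOne.eventually
      (eventually_differentiableAt_of_contDiffAt (contDiffAt_chartConj (E := E) (G := G))),
    tendsto_mk_chartOne.eventually (chartMul_chartConj (E := E) (G := G)).eventually_nhds]
    with u hu1 hu2 hu3 hu4 Y
  have h5 : HasFDerivAt (fun v : E => ((u, v) : E × E)) (ContinuousLinearMap.inr ℝ E E)
    (chartOne E G) := hasFDerivAt_prodMk_right u (chartOne E G)
  have e1 := HasFDerivAt.comp (g := chartMul E G) (chartOne E G) hu1.hasFDerivAt h5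
  have e2 := HasFDerivAt.comp (g := chartConj E G) (chartOne E G) hu3.hasFDerivAt h5
  have e3 := e2.prodMk (hasFDerivAt_const u (chartOne E G))
  have hu2' : HasFDerivAt (chartMul E G) (fderiv ℝ (chartMul E G) (chartOne E G, u))
      ((chartConj E G ∘ fun v : E => ((u, v) : E × E)) (chartOne E G), u) := by
    simp only [Function.comp, chartConj_chartOne_right]
    exact hu2.hasFDerivAt
  have e4 := HasFDerivAt.comp (g := chartMul E G) (chartOne E G) hu2' e3
  have h7 : (fun v : E => chartMul E G (chartConj E G (u, v), u)) =ᶠ[𝓝 (chartOne E G)]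
      (fun v : E => chartMul E G (u, v)) :=
    (Continuous.prodMk_right u).continuousAt.eventually hu4
  have h8 := e4.unique (e1.congr_of_eventuallyEq h7)
  exact congrArg (fun L : E →L[ℝ] E => L Y) h8

/-- Mere existence is enough here; the value is found afterwards by uniqueness of derivatives. -/
theorem hasFDerivAt_fderiv_chartConj (Y : E) :
    ∃ D : E →L[ℝ] E, HasFDerivAt (fun u => fderiv ℝ (chartConj E G) (u, chartOne E G) (0, Y)) D
      (chartOne E G) := by
  have h1 : DifferentiableAt ℝ (fderiv ℝ (chartConj E G)) (chartOne E G, chartOne E G) :=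
    ((contDiffAt_chartConj (E := E) (G := G)).fderiv_right (m := 1) (by norm_cast)).differentiableAt
      (by simp)
  have h5 : HasFDerivAt (fun v : E => ((v, chartOne E G) : E × E)) (ContinuousLinearMap.inl ℝ E E)
    (chartOne E G) := hasFDerivAt_prodMk_left _ _
  have h2 := HasFDerivAt.comp (g := fderiv ℝ (chartConj E G))
    (f := fun v : E => ((v, chartOne E G) : E × E)) (chartOne E G) h1.hasFDerivAt h5
  exact ⟨_, h2.clm_apply (hasFDerivAt_const ((0, Y) : E × E) (chartOne E G))⟩

theorem hasFDerivAt_fderiv_chartMul (Y : E) :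
    HasFDerivAt (fun u => fderiv ℝ (chartMul E G) (u, chartOne E G) (0, Y))
      (((fderiv ℝ (fderiv ℝ (chartMul E G)) (chartOne E G, chartOne E G)).comp
        (ContinuousLinearMap.inl ℝ E E)).flip (0, Y)) (chartOne E G) := by
  have h1 : DifferentiableAt ℝ (fderiv ℝ (chartMul E G)) (chartOne E G, chartOne E G) :=
    ((contDiffAt_chartMul (E := E) (G := G)).fderiv_right (m := 1) (by norm_cast)).differentiableAt
      (by simp)
  have h5 : HasFDerivAt (fun v : E => ((v, chartOne E G) : E × E)) (ContinuousLinearMap.inl ℝ E E)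
    (chartOne E G) := hasFDerivAt_prodMk_left _ _
  have h2 := HasFDerivAt.comp (g := fderiv ℝ (chartMul E G))
    (f := fun v : E => ((v, chartOne E G) : E × E)) (chartOne E G) h1.hasFDerivAt h5
  have h3 := h2.clm_apply (hasFDerivAt_const ((0, Y) : E × E) (chartOne E G))
  refine h3.congr_fderiv ?_
  ext v
  simp

/-- The first partial derivatives of multiplication at the unit are identities, so only the mixed
second derivative survives, antisymmetrized. -/
theorem lieBracket_fderiv_chartMul (X Y : E) :
    lieBracket ℝ (fun u => fderiv ℝ (chartMul E G) (u, chartOne E G) (0, X))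
      (fun u => fderiv ℝ (chartMul E G) (u, chartOne E G) (0, Y)) (chartOne E G) =
      fderiv ℝ (fderiv ℝ (chartMul E G)) (chartOne E G, chartOne E G) (X, 0) (0, Y) -
        fderiv ℝ (fderiv ℝ (chartMul E G)) (chartOne E G, chartOne E G) (Y, 0) (0, X) := by
  rw [lieBracket_eq]
  simp only [(hasFDerivAt_fderiv_chartMul (G := G) X).fderiv,
    (hasFDerivAt_fderiv_chartMul (G := G) Y).fderiv, fderiv_chartMul_right]
  simp

theorem bracket_eq_lieBracket_fderiv_chartMul (X Y : GroupLieAlgebra 𝓘(ℝ, E) G) :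
    @Eq E (⁅X, Y⁆ : GroupLieAlgebra 𝓘(ℝ, E) G)
      (lieBracket ℝ (fun u => fderiv ℝ (chartMul E G) (u, chartOne E G) (0, X))
        (fun u => fderiv ℝ (chartMul E G) (u, chartOne E G) (0, Y)) (chartOne E G)) := by
  have : IsManifold 𝓘(ℝ, E) 1 G := IsManifold.of_le (n := ∞) (by norm_cast)
  rw [GroupLieAlgebra.bracket_def, mlieBracket_eq_lieBracket_chartField]
  have h : ∀ Z : GroupLieAlgebra 𝓘(ℝ, E) G, chartField (mulInvariantVectorField Z) (1 : G)
      =ᶠ[𝓝 (chartOne E G)] fun u => fderiv ℝ (chartMul E G) (u, chartOne E G) (0, Z) := by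
    intro Z
    filter_upwards [chartField_mulInvariantVectorField (E := E) (G := G)] with u hu using hu Z
  exact Filter.EventuallyEq.lieBracket_vectorField_eq (𝕜 := ℝ) (h X) (h Y)

/-- This is $d\,\mathrm{Ad}=\mathrm{ad}$ in the chart. The identity of
`fderiv_chartMul_fderiv_chartConj` is differentiated in $u$ at the unit; symmetry of the second
derivative turns the extra term into the second half of the bracket. -/
theorem fderiv_fderiv_chartConj (X Y : E) :
    fderiv ℝ (fun u => fderiv ℝ (chartConj E G) (u, chartOne E G) (0, Y)) (chartOne E G) X =
      lieBracket ℝ (fun u => fderiv ℝ (chartMul E G) (u, chartOne E G) (0, X))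
        (fun u => fderiv ℝ (chartMul E G) (u, chartOne E G) (0, Y)) (chartOne E G) := by
  obtain ⟨D, hD⟩ := hasFDerivAt_fderiv_chartConj (G := G) Y
  rw [hD.fderiv, lieBracket_fderiv_chartMul]
  have h1 : DifferentiableAt ℝ (fderiv ℝ (chartMul E G)) (chartOne E G, chartOne E G) :=
    ((contDiffAt_chartMul (E := E) (G := G)).fderiv_right (m := 1) (by norm_cast)).differentiableAt
      (by simp)
  have h5 : HasFDerivAt (fun v : E => ((chartOne E G, v) : E × E)) (ContinuousLinearMap.inr ℝ E E)
    (chartOne E G) := hasFDerivAt_prodMk_right _ _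
  have h2 := HasFDerivAt.comp (g := fderiv ℝ (chartMul E G)) (chartOne E G) h1.hasFDerivAt h5
  have h3 := h2.clm_apply (hD.prodMk (hasFDerivAt_const (0 : E) (chartOne E G)))
  have h4 : (fun u => fderiv ℝ (chartMul E G) (chartOne E G, u)
        (fderiv ℝ (chartConj E G) (u, chartOne E G) (0, Y), 0)) =ᶠ[𝓝 (chartOne E G)]
      fun u => fderiv ℝ (chartMul E G) (u, chartOne E G) (0, Y) := by
    filter_upwards [fderiv_chartMul_fderiv_chartConj (E := E) (G := G)] with u hu using hu Y
  have h6 := h3.unique ((hasFDerivAt_fderiv_chartMul (G := G) Y).congr_of_eventuallyEq h4)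
  have h7 := congrArg (fun L : E →L[ℝ] E => L X) h6
  simp [fderiv_chartConj_chartOne, fderiv_chartMul_left] at h7
  have hs : IsSymmSndFDerivAt ℝ (chartMul E G) (chartOne E G, chartOne E G) :=
    (contDiffAt_chartMul (E := E) (G := G)).isSymmSndFDerivAt
      (by simp only [minSmoothness_of_isRCLikeNormedField]; norm_cast)
  rw [← h7, hs.eq (0, X) (Y, 0)]
  abel

/-- The orbit map `a ↦ Ad(a) Y`, as a map from `G` to the model space. -/
def adjointOrbit (Y : GroupLieAlgebra 𝓘(ℝ, E) G) (a : G) : E := adjointAction a Y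

theorem adjointOrbit_eventuallyEq (Y : GroupLieAlgebra 𝓘(ℝ, E) G) :
    adjointOrbit Y =ᶠ[𝓝 (1 : G)]
      (fun u => fderiv ℝ (chartConj E G) (u, chartOne E G) (0, Y)) ∘
        extChartAt 𝓘(ℝ, E) (1 : G) := by
  have h : Tendsto (extChartAt 𝓘(ℝ, E) (1 : G)) (𝓝 1) (𝓝 (chartOne E G)) :=
    continuousAt_extChartAt (I := 𝓘(ℝ, E)) (1 : G)
  filter_upwards [h.eventually (adjointAction_eq_fderiv_chartConj (E := E) (G := G)),
    extChartAt_source_mem_nhds (I := 𝓘(ℝ, E)) (1 : G)] with a ha hs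
  have := ha Y
  rw [(extChartAt 𝓘(ℝ, E) (1 : G)).left_inv hs] at this
  exact this

theorem hasMFDerivAt_adjointOrbit_one (Y : GroupLieAlgebra 𝓘(ℝ, E) G) :
    ∃ D : E →L[ℝ] E, HasMFDerivAt 𝓘(ℝ, E) 𝓘(ℝ, E) (adjointOrbit Y) (1 : G) D ∧
      ∀ X : GroupLieAlgebra 𝓘(ℝ, E) G, @Eq E (D X) (⁅X, Y⁆ : GroupLieAlgebra 𝓘(ℝ, E) G) := by
  have : IsManifold 𝓘(ℝ, E) 1 G := IsManifold.of_le (n := ∞) (by norm_cast)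
  obtain ⟨D, hD⟩ := hasFDerivAt_fderiv_chartConj (E := E) (G := G) Y
  refine ⟨D, ?_, fun X => ?_⟩
  · have h1 : HasMFDerivAt 𝓘(ℝ, E) 𝓘(ℝ, E) (extChartAt 𝓘(ℝ, E) (1 : G)) 1
        (ContinuousLinearMap.id ℝ E) := by
      have := (mdifferentiableAt_extChartAt (I := 𝓘(ℝ, E)) (mem_chart_source E (1 : G))).hasMFDerivAt
      rw [mfderiv_extChartAt_self] at this
      exact this
    have h2 := HasMFDerivAt.comp (I' := 𝓘(ℝ, E)) (I'' := 𝓘(ℝ, E)) (1 : G) hD.hasMFDerivAt h1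
    exact h2.congr_of_eventuallyEq (adjointOrbit_eventuallyEq Y)
  · exact (congrArg (fun L : E →L[ℝ] E => L X) hD.fderiv).symm.trans
      ((fderiv_fderiv_chartConj (E := E) (G := G) X Y).trans
        (bracket_eq_lieBracket_fderiv_chartMul X Y).symm)

theorem adjointOrbit_one (Y : GroupLieAlgebra 𝓘(ℝ, E) G) : @Eq E (adjointOrbit Y 1) Y := by
  have h : (fun x : G => (1 : G) * x * (1 : G)⁻¹) = id := by ext; simp
  have := mfderiv_congr (I := 𝓘(ℝ, E)) (I' := 𝓘(ℝ, E)) (x := (1 : G)) h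
  exact congrArg (fun L : E →L[ℝ] E => L Y) (this.trans mfderiv_id)

/-- `Ad(a)` as a continuous linear map of the model space. -/
def adjointCLM (a : G) : E →L[ℝ] E := mfderiv 𝓘(ℝ, E) 𝓘(ℝ, E) (fun x : G => a * x * a⁻¹) 1

theorem adjointOrbit_mul (a b : G) (Y : GroupLieAlgebra 𝓘(ℝ, E) G) :
    adjointOrbit Y (a * b) = adjointCLM a (adjointOrbit Y b) := by
  have h : (fun x : G => (a * b) * x * (a * b)⁻¹) =
      (fun x : G => a * x * a⁻¹) ∘ (fun x : G => b * x * b⁻¹) := by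
    ext x; simp [mul_assoc]
  have h1 := mfderiv_congr (I := 𝓘(ℝ, E)) (I' := 𝓘(ℝ, E)) (x := (1 : G)) h
  have h2 := mfderiv_comp (I := 𝓘(ℝ, E)) (I' := 𝓘(ℝ, E)) (I'' := 𝓘(ℝ, E)) (1 : G)
    (f := fun x : G => b * x * b⁻¹) (g := fun x : G => a * x * a⁻¹)
    (mdifferentiable_conj a _) (mdifferentiable_conj b 1)
  have h3 : (mfderiv 𝓘(ℝ, E) 𝓘(ℝ, E) (fun x : G => a * x * a⁻¹) (b * 1 * b⁻¹) : E →L[ℝ] E) =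
      mfderiv 𝓘(ℝ, E) 𝓘(ℝ, E) (fun x : G => a * x * a⁻¹) 1 :=
    mfderiv_congr_point (by simp)
  have h4 := congrArg (fun L : E →L[ℝ] E => L Y) (h1.trans h2)
  exact h4.trans (congrArg (fun L : E →L[ℝ] E => L (adjointOrbit Y b)) h3)

theorem mdifferentiableAt_adjointOrbit (Y : GroupLieAlgebra 𝓘(ℝ, E) G) (a : G) :
    MDifferentiableAt 𝓘(ℝ, E) 𝓘(ℝ, E) (adjointOrbit Y) a := by
  -- $\mathrm{Ad}(x)=\mathrm{Ad}(a)\,\mathrm{Ad}(a^{-1}x)$ carries differentiability from the unit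
  -- to `a`.
  have h : adjointOrbit Y = adjointCLM a ∘ adjointOrbit Y ∘ (fun x : G => a⁻¹ * x) := by
    ext x
    simp only [Function.comp, ← adjointOrbit_mul, mul_inv_cancel_left]
  rw [h]
  obtain ⟨D, hD, -⟩ := hasMFDerivAt_adjointOrbit_one Y
  refine MDifferentiableAt.comp a (I' := 𝓘(ℝ, E)) (g := adjointCLM a)
    (adjointCLM a).mdifferentiableAt ?_
  refine MDifferentiableAt.comp a (I' := 𝓘(ℝ, E)) ?_ (mdifferentiable_leftMul a⁻¹ a)
  rw [inv_mul_cancel]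
  exact hD.mdifferentiableAt

/-- The derivative of `a ↦ Ad(a) Y` along a left invariant field. -/
theorem mfderiv_adjointOrbit (X Y : GroupLieAlgebra 𝓘(ℝ, E) G) (a : G) :
    @Eq E (mfderiv 𝓘(ℝ, E) 𝓘(ℝ, E) (adjointOrbit Y) a (mulInvariantVectorField X a))
      (adjointOrbit ⁅X, Y⁆ a) := by
  obtain ⟨D, hD, hDX⟩ := hasMFDerivAt_adjointOrbit_one Y
  have h : adjointOrbit Y ∘ (fun x : G => a * x) = adjointCLM a ∘ adjointOrbit Y := by
    ext x
    simp only [Function.comp, ← adjointOrbit_mul]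
  have h1 := mfderiv_congr (I := 𝓘(ℝ, E)) (I' := 𝓘(ℝ, E)) (x := (1 : G)) h
  have h2 := mfderiv_comp (I := 𝓘(ℝ, E)) (I' := 𝓘(ℝ, E)) (I'' := 𝓘(ℝ, E)) (1 : G)
    (f := fun x : G => a * x) (g := adjointOrbit Y)
    (mdifferentiableAt_adjointOrbit Y _) (mdifferentiable_leftMul a 1)
  have h3 := (HasMFDerivAt.comp (I' := 𝓘(ℝ, E)) (I'' := 𝓘(ℝ, E)) (1 : G)
    (adjointCLM a).hasMFDerivAt hD).mfderiv
  have h4 := congrArg (fun L : E →L[ℝ] E => L X) (h2.symm.trans (h1.trans h3))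
  have h5 : (mfderiv 𝓘(ℝ, E) 𝓘(ℝ, E) (adjointOrbit Y) (a * 1) : E →L[ℝ] E) =
      mfderiv 𝓘(ℝ, E) 𝓘(ℝ, E) (adjointOrbit Y) a :=
    mfderiv_congr_point (mul_one a)
  refine (congrArg (fun L : E →L[ℝ] E => L (mulInvariantVectorField X a : E)) h5).symm.trans ?_
  exact h4.trans (congrArg (adjointCLM a) (hDX X))

end Adjoint

/-! ### Fundamental vector fields on a homogeneous space -/

section Fundamental

open VectorField Set Filter
open scoped Topology

/-! ### Inversion and left invariant fields on a Lie group -/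

section Group

variable {E : Type*} [NormedAddCommGroup E] [NormedSpace ℝ E]
  {G : Type*} [TopologicalSpace G] [ChartedSpace E G] [Group G] [LieGroup 𝓘(ℝ, E) ∞ G]

theorem mdifferentiable_inv_group : MDifferentiable 𝓘(ℝ, E) 𝓘(ℝ, E) (fun x : G => x⁻¹) :=
  (contMDiff_inv 𝓘(ℝ, E) ∞).mdifferentiable (by simp)

theorem mfderiv_inv_one :
    @Eq (E →L[ℝ] E) (mfderiv 𝓘(ℝ, E) 𝓘(ℝ, E) (fun x : G => x⁻¹) 1)
      (-ContinuousLinearMap.id ℝ E) := by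
  have : IsManifold 𝓘(ℝ, E) 1 G := IsManifold.of_le (n := ∞) (by norm_cast)
  have hm : MDifferentiableAt 𝓘(ℝ, E) 𝓘(ℝ, E) (extChartAt 𝓘(ℝ, E) (1 : G)) (1⁻¹ : G) := by
    rw [inv_one]
    exact mdifferentiableAt_extChartAt (mem_chart_source E (1 : G))
  have hmc := hm.comp (1 : G) (f := fun x : G => x⁻¹) (mdifferentiable_inv_group 1)
  have h2 := mfderiv_comp (I := 𝓘(ℝ, E)) (I' := 𝓘(ℝ, E)) (I'' := 𝓘(ℝ, E)) (1 : G)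
    (f := fun x : G => x⁻¹) (g := extChartAt 𝓘(ℝ, E) (1 : G)) hm (mdifferentiable_inv_group 1)
  have h3 : (mfderiv 𝓘(ℝ, E) 𝓘(ℝ, E) (extChartAt 𝓘(ℝ, E) (1 : G)) (1⁻¹ : G) : E →L[ℝ] E) =
      ContinuousLinearMap.id ℝ E :=
    (mfderiv_congr_point inv_one).trans mfderiv_extChartAt_self
  set J : E → E := (extChartAt 𝓘(ℝ, E) (1 : G) ∘ fun x : G => x⁻¹) ∘
    (extChartAt 𝓘(ℝ, E) (1 : G)).symm with hJ
  have hJd : DifferentiableAt ℝ J (chartOne E G) := by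
    rw [← mdifferentiableAt_iff_differentiableAt]
    refine MDifferentiableAt.comp (I' := 𝓘(ℝ, E)) (chartOne E G) ?_
      ((contMDiffAt_extChartAt_symm_one (G := G) chartOne_mem_target).mdifferentiableAt (by simp))
    rw [extChartAt_symm_chartOne]
    exact hmc
  have hJc : J (chartOne E G) = chartOne E G := by
    simp only [hJ, Function.comp, extChartAt_symm_chartOne, inv_one]
    rfl
  -- Differentiating $u\cdot u^{-1}=1$, where both partial derivatives of multiplication are
  -- identities, forces the derivative of inversion to be $-1$.
  have hcomp : (fun u => chartMul E G (u, J u)) =ᶠ[𝓝 (chartOne E G)] fun _ => chartOne E G := by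
    have hc : Tendsto (fun u => ((extChartAt 𝓘(ℝ, E) (1 : G)).symm u)⁻¹) (𝓝 (chartOne E G))
        (𝓝 ((1 : G)⁻¹)) := by
      have h1 := continuousAt_extChartAt_symm (I := 𝓘(ℝ, E)) (1 : G)
      have : IsTopologicalGroup G := topologicalGroup_of_lieGroup 𝓘(ℝ, E) ∞
      have h2 := h1.inv
      have h3 : ((extChartAt 𝓘(ℝ, E) (1 : G)).symm (chartOne E G))⁻¹ = (1 : G)⁻¹ := by
        rw [extChartAt_symm_chartOne]
      rw [← h3]
      exact h2
    rw [inv_one] at hc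
    filter_upwards [hc.eventually (extChartAt_source_mem_nhds (I := 𝓘(ℝ, E)) (1 : G))] with u hu
    simp only [chartMul, hJ, Function.comp]
    rw [(extChartAt 𝓘(ℝ, E) (1 : G)).left_inv hu, mul_inv_cancel]
    rfl
  have hd : HasFDerivAt (chartMul E G) (fderiv ℝ (chartMul E G) (chartOne E G, chartOne E G))
      (chartOne E G, J (chartOne E G)) := by
    rw [hJc]
    exact ((contDiffAt_chartMul (E := E) (G := G)).differentiableAt (by simp)).hasFDerivAt
  have h4 := HasFDerivAt.comp (g := chartMul E G) (f := fun u => (u, J u)) (chartOne E G) hd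
    ((hasFDerivAt_id (chartOne E G)).prodMk hJd.hasFDerivAt)
  have h5 := (h4.congr_of_eventuallyEq hcomp.symm).unique (hasFDerivAt_const _ _)
  have h6 : ∀ v : E, fderiv ℝ J (chartOne E G) v = -v := by
    intro v
    have h7 : fderiv ℝ (chartMul E G) (chartOne E G, chartOne E G)
        (v, fderiv ℝ J (chartOne E G) v) = 0 := congrArg (fun L : E →L[ℝ] E => L v) h5
    have h8 : ((v, fderiv ℝ J (chartOne E G) v) : E × E) =
        (v, 0) + (0, fderiv ℝ J (chartOne E G) v) := by simp
    rw [h8, map_add, fderiv_chartMul_left, fderiv_chartMul_right] at h7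
    exact eq_neg_of_add_eq_zero_right h7
  refine ContinuousLinearMap.ext fun v => ?_
  have h9 := mfderiv_apply_eq_fderiv_comp_extChartAt_symm hmc v
  have h10 := congrArg (fun L : E →L[ℝ] E => L v) h2
  have h11 := congrArg (fun L : E →L[ℝ] E =>
    L (mfderiv 𝓘(ℝ, E) 𝓘(ℝ, E) (fun x : G => x⁻¹) 1 v : E)) h3
  exact (h11.symm.trans (h10.symm.trans h9)).trans (h6 v)

/-- The field is $a\mapsto T\mu(0_a,v)$ with $\mu$ the multiplication: a tangent map composed with
the zero section paired with a constant. -/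
theorem contMDiff_infty_mulInvariantVectorField (v : GroupLieAlgebra 𝓘(ℝ, E) G) :
    ContMDiff 𝓘(ℝ, E) 𝓘(ℝ, E).tangent ∞
      (fun a : G => (⟨a, mulInvariantVectorField v a⟩ : TangentBundle 𝓘(ℝ, E) G)) := by
  let fg : G → TangentBundle 𝓘(ℝ, E) G := fun g ↦ TotalSpace.mk' E g 0
  have sfg : CMDiff ∞ fg := contMDiff_zeroSection _ _
  let fv : G → TangentBundle 𝓘(ℝ, E) G := fun _ ↦ TotalSpace.mk' E 1 v
  have sfv : CMDiff ∞ fv := contMDiff_const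
  let F₁ : G → (TangentBundle 𝓘(ℝ, E) G × TangentBundle 𝓘(ℝ, E) G) := fun g ↦ (fg g, fv g)
  have S₁ : CMDiff ∞ F₁ := sfg.prodMk sfv
  let F₂ : (TangentBundle 𝓘(ℝ, E) G × TangentBundle 𝓘(ℝ, E) G) →
    TangentBundle (𝓘(ℝ, E).prod 𝓘(ℝ, E)) (G × G) :=
    (equivTangentBundleProd 𝓘(ℝ, E) G 𝓘(ℝ, E) G).symm
  have S₂ : CMDiff ∞ F₂ := contMDiff_equivTangentBundleProd_symm
  let F₃ : TangentBundle (𝓘(ℝ, E).prod 𝓘(ℝ, E)) (G × G) → TangentBundle 𝓘(ℝ, E) G :=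
    tangentMap (𝓘(ℝ, E).prod 𝓘(ℝ, E)) 𝓘(ℝ, E) (fun (p : G × G) ↦ p.1 * p.2)
  have S₃ : CMDiff ∞ F₃ :=
    ContMDiff.contMDiff_tangentMap (contMDiff_mul 𝓘(ℝ, E) ∞) (m := ∞) (by norm_cast)
  have S := (S₃.comp S₂).comp S₁
  refine S.congr fun g => ?_
  let w : E := v
  have hg : (F₃ ∘ F₂) (F₁ g) = (⟨g * 1, (mfderiv (𝓘(ℝ, E).prod 𝓘(ℝ, E)) 𝓘(ℝ, E)
    (fun (p : G × G) ↦ p.1 * p.2) (g, 1) ((0 : E), w) : E)⟩ : TangentBundle 𝓘(ℝ, E) G) := rfl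
  have hd := mfderiv_prod_eq_add_apply (p := (g, (1 : G))) (v := ((0 : E), w))
    ((contMDiff_mul 𝓘(ℝ, E) ∞ (G := G)).mdifferentiable (by simp) (g, 1))
  have key : ∀ (q : G) (_ : q = g) (w : E), w = (mulInvariantVectorField v g : E) →
      (⟨g, mulInvariantVectorField v g⟩ : TangentBundle 𝓘(ℝ, E) G) = ⟨q, w⟩ := by
    rintro q rfl w rfl; rfl
  refine (key (g * 1) (mul_one g) _ ?_).trans hg.symm
  have e : ∀ u w' : E, u = 0 → u + w' = w' := by
    rintro _ w' rfl
    exact zero_add w'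
  exact hd.trans (e _ _ (map_zero (mfderiv 𝓘(ℝ, E) 𝓘(ℝ, E) (fun z : G => z * 1) g)))

theorem mulInvariantVectorField_mul (a b : G) (X : GroupLieAlgebra 𝓘(ℝ, E) G) :
    @Eq E (mulInvariantVectorField X (a * b))
      (mfderiv 𝓘(ℝ, E) 𝓘(ℝ, E) (fun x : G => a * x) b (mulInvariantVectorField X b)) := by
  have h : (fun x : G => (a * b) * x) = (fun x : G => a * x) ∘ (fun x : G => b * x) := by
    ext x; simp [mul_assoc]
  have h1 := mfderiv_congr (I := 𝓘(ℝ, E)) (I' := 𝓘(ℝ, E)) (x := (1 : G)) h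
  have h2 := mfderiv_comp (I := 𝓘(ℝ, E)) (I' := 𝓘(ℝ, E)) (I'' := 𝓘(ℝ, E)) (1 : G)
    (f := fun x : G => b * x) (g := fun x : G => a * x)
    (mdifferentiable_leftMul a _) (mdifferentiable_leftMul b 1)
  have h3 : (mfderiv 𝓘(ℝ, E) 𝓘(ℝ, E) (fun x : G => a * x) (b * 1) : E →L[ℝ] E) =
      mfderiv 𝓘(ℝ, E) 𝓘(ℝ, E) (fun x : G => a * x) b := mfderiv_congr_point (mul_one b)
  have h4 := congrArg (fun L : E →L[ℝ] E => L X) (h1.trans h2)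
  exact h4.trans (congrArg (fun L : E →L[ℝ] E => L (mulInvariantVectorField X b)) h3)

theorem mulInvariantVectorField_one (X : GroupLieAlgebra 𝓘(ℝ, E) G) :
    @Eq E (mulInvariantVectorField X (1 : G)) X := by
  have h : (fun x : G => 1 * x) = id := by ext; simp
  have := mfderiv_congr (I := 𝓘(ℝ, E)) (I' := 𝓘(ℝ, E)) (x := (1 : G)) h
  exact congrArg (fun L : E →L[ℝ] E => L X) (this.trans mfderiv_id)

end Group

/-- A submersion has smooth local sections through every point. -/
theorem exists_section_of_isSubmersionAt {E : Type*} [NormedAddCommGroup E] [NormedSpace ℝ E]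
    {F : Type*} [NormedAddCommGroup F] [NormedSpace ℝ F]
    {N : Type*} [TopologicalSpace N] [ChartedSpace E N] [IsManifold 𝓘(ℝ, E) ∞ N]
    {M : Type*} [TopologicalSpace M] [ChartedSpace F M] [IsManifold 𝓘(ℝ, F) ∞ M]
    {f : N → M} {a : N} (hf : IsSubmersionAt 𝓘(ℝ, E) 𝓘(ℝ, F) ∞ f a) :
    ∃ s : M → N, ContMDiffAt 𝓘(ℝ, F) 𝓘(ℝ, E) ∞ s (f a) ∧ s (f a) = a ∧
      ∀ᶠ q in 𝓝 (f a), f (s q) = q := by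
  obtain ⟨F', _, _, h⟩ := hf
  set φ := h.domChart with hφ
  set ψ := h.codChart with hψ
  set L := h.equiv with hL
  have hφa := h.mem_domChart_source
  have hψa := h.mem_codChart_source
  have hw : ∀ u ∈ φ.target, ψ (f (φ.symm u)) = (L u).1 := fun u hu =>
    h.writtenInCharts (by simpa using hu)
  have hLa : L (φ a) = (ψ (f a), (L (φ a)).2) := by
    refine Prod.ext ?_ rfl
    rw [← hw (φ a) (φ.map_source hφa), φ.left_inv hφa]
  -- In adapted charts a submersion is a linear projection; the section freezes the complementary
  -- coordinate at its value at `a`.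
  let t : F → E := fun w => L.symm (w, (L (φ a)).2)
  have ht : t (ψ (f a)) = φ a := by simp only [t, ← hLa, L.symm_apply_apply]
  have htc : ContMDiff 𝓘(ℝ, F) 𝓘(ℝ, E) ∞ t := by
    rw [contMDiff_iff_contDiff]
    exact L.symm.contDiff.comp (contDiff_id.prodMk contDiff_const)
  have hψc : ContMDiffAt 𝓘(ℝ, F) 𝓘(ℝ, F) ∞ ψ (f a) :=
    contMDiffAt_of_mem_maximalAtlas h.codChart_mem_maximalAtlas hψa
  have hφc : ContMDiffAt 𝓘(ℝ, E) 𝓘(ℝ, E) ∞ φ.symm (φ a) :=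
    contMDiffAt_symm_of_mem_maximalAtlas h.domChart_mem_maximalAtlas (φ.map_source hφa)
  have h1 : ContMDiffAt 𝓘(ℝ, F) 𝓘(ℝ, E) ∞ (t ∘ ψ) (f a) := htc.contMDiffAt.comp _ hψc
  have h2 : ContMDiffAt 𝓘(ℝ, F) 𝓘(ℝ, E) ∞ (φ.symm ∘ t ∘ ψ) (f a) := by
    refine ContMDiffAt.comp (I' := 𝓘(ℝ, E)) _ ?_ h1
    simp only [Function.comp, ht]
    exact hφc
  refine ⟨φ.symm ∘ t ∘ ψ, h2, by simp only [Function.comp, ht, φ.left_inv hφa], ?_⟩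
  have h3 : ∀ᶠ q in 𝓝 (f a), t (ψ q) ∈ φ.target := by
    refine h1.continuousAt.eventually (φ.open_target.mem_nhds ?_)
    simp only [Function.comp, ht]
    exact φ.map_source hφa
  filter_upwards [h3, ψ.open_source.mem_nhds hψa] with q hq hq'
  refine ψ.injOn (h.mapsto_domChart_source_codChart_source (φ.map_target hq)) hq' ?_
  refine (hw _ hq).trans ?_
  simp [t]

/-! ### Pushing left invariant fields forward along $a\mapsto a^{-1}H$ -/

section Quotient

variable {E : Type*} [NormedAddCommGroup E] [NormedSpace ℝ E]
  {G : Type*} [TopologicalSpace G] [ChartedSpace E G] [Group G]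
  (H : Subgroup G)
  {F : Type*} [NormedAddCommGroup F] [NormedSpace ℝ F]
  [ChartedSpace F (G ⧸ H)]

/-- The map `a ↦ a⁻¹H`. -/
def cosetInv (a : G) : G ⧸ H := ((a⁻¹ : G) : G ⧸ H)

theorem cosetInv_surjective : Function.Surjective (cosetInv H) := by
  intro p
  obtain ⟨a, rfl⟩ := QuotientGroup.mk_surjective p
  exact ⟨a⁻¹, by simp [cosetInv]⟩

theorem cosetInv_eq_iff {a b : G} : cosetInv H a = cosetInv H b ↔ a * b⁻¹ ∈ H := by
  simp only [cosetInv]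
  rw [QuotientGroup.eq, inv_inv]

variable (F) in
/-- The fundamental vector field of the action of `G` on `G ⧸ H` that corresponds to `-X`: it is
related through `a ↦ a⁻¹H` to the left invariant vector field of `X`. -/
def fundamentalField (X : GroupLieAlgebra 𝓘(ℝ, E) G) (p : G ⧸ H) : TangentSpace 𝓘(ℝ, F) p :=
  (mfderiv 𝓘(ℝ, E) 𝓘(ℝ, F) (cosetInv H) (Function.surjInv (cosetInv_surjective H) p)
    (mulInvariantVectorField X (Function.surjInv (cosetInv_surjective H) p)) : F)

variable {H} [LieGroup 𝓘(ℝ, E) ∞ G] [IsManifold 𝓘(ℝ, F) ∞ (G ⧸ H)]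

theorem contMDiff_cosetInv (hM : IsHomogeneousSpace E H F) :
    ContMDiff 𝓘(ℝ, E) 𝓘(ℝ, F) ∞ (cosetInv H) :=
  hM.contMDiff.comp (contMDiff_inv 𝓘(ℝ, E) ∞)

theorem mdifferentiable_cosetInv (hM : IsHomogeneousSpace E H F) :
    MDifferentiable 𝓘(ℝ, E) 𝓘(ℝ, F) (cosetInv H) :=
  (contMDiff_cosetInv hM).mdifferentiable (by simp)

theorem exists_section_cosetInv (hM : IsHomogeneousSpace E H F) (a : G) :
    ∃ s : G ⧸ H → G, ContMDiffAt 𝓘(ℝ, F) 𝓘(ℝ, E) ∞ s (cosetInv H a) ∧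
      s (cosetInv H a) = a ∧ ∀ᶠ q in 𝓝 (cosetInv H a), cosetInv H (s q) = q := by
  obtain ⟨s, hs, hsa, hsq⟩ := exists_section_of_isSubmersionAt (hM.isSubmersionAt (a⁻¹))
  refine ⟨fun q => (s q)⁻¹, ContMDiffAt.inv hs, ?_, ?_⟩
  · exact (congrArg _ hsa).trans (inv_inv a)
  · filter_upwards [hsq] with q hq
    simpa [cosetInv] using hq

/-- The chosen preimage does not matter: two preimages differ by left translation by an element of
`H`, which preserves both `cosetInv H` and the left invariant field. -/
theorem fundamentalField_cosetInv (hM : IsHomogeneousSpace E H F)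
    (X : GroupLieAlgebra 𝓘(ℝ, E) G) (b : G) :
    @Eq F (fundamentalField H F X (cosetInv H b))
      (mfderiv 𝓘(ℝ, E) 𝓘(ℝ, F) (cosetInv H) b (mulInvariantVectorField X b)) := by
  set a := Function.surjInv (cosetInv_surjective H) (cosetInv H b) with ha
  have hab : cosetInv H a = cosetInv H b := Function.surjInv_eq _ _
  set h := a * b⁻¹ with hh
  have hmem : h ∈ H := (cosetInv_eq_iff H).1 hab
  have hah : a = h * b := by simp [hh]
  have hcomp : cosetInv H = cosetInv H ∘ (fun x : G => h * x) := by
    ext x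
    simp only [Function.comp]
    rw [cosetInv_eq_iff]
    simpa using H.inv_mem hmem
  have h1 := mfderiv_congr (I := 𝓘(ℝ, E)) (I' := 𝓘(ℝ, F)) (x := b) hcomp
  have h2 := mfderiv_comp (I := 𝓘(ℝ, E)) (I' := 𝓘(ℝ, E)) (I'' := 𝓘(ℝ, F)) b
    (f := fun x : G => h * x) (g := cosetInv H)
    (mdifferentiable_cosetInv hM _) (mdifferentiable_leftMul h b)
  have h3 := congrArg (fun L : E →L[ℝ] F => L (mulInvariantVectorField X b)) (h1.trans h2)
  have h4 : ∀ a', a' = h * b → @Eq F (mfderiv 𝓘(ℝ, E) 𝓘(ℝ, F) (cosetInv H) a'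
      (mulInvariantVectorField X a')) (mfderiv 𝓘(ℝ, E) 𝓘(ℝ, F) (cosetInv H) (h * b)
      (mulInvariantVectorField X (h * b))) := by rintro _ rfl; rfl
  refine (h4 a hah).trans (Eq.trans ?_ h3.symm)
  exact congrArg (mfderiv 𝓘(ℝ, E) 𝓘(ℝ, F) (cosetInv H) (h * b))
    (mulInvariantVectorField_mul h b X)

/-- Along a smooth local section of `cosetInv H` the field is a composite of smooth maps. -/
theorem contMDiff_fundamentalField (hM : IsHomogeneousSpace E H F)
    (X : GroupLieAlgebra 𝓘(ℝ, E) G) :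
    ContMDiff 𝓘(ℝ, F) 𝓘(ℝ, F).tangent ∞
      (fun p : G ⧸ H => (⟨p, fundamentalField H F X p⟩ : TangentBundle 𝓘(ℝ, F) (G ⧸ H))) := by
  intro p
  obtain ⟨a, rfl⟩ := cosetInv_surjective H p
  obtain ⟨s, hs, -, hsq⟩ := exists_section_cosetInv hM a
  have h1 := (contMDiff_cosetInv hM).contMDiff_tangentMap (m := ∞) (by norm_cast)
  have h2 := (h1.comp (contMDiff_infty_mulInvariantVectorField X)).contMDiffAt.comp
    (cosetInv H a) hs
  refine h2.congr_of_eventuallyEq ?_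
  filter_upwards [hsq] with q hq
  have key : ∀ (q' : G ⧸ H) (_ : q' = q) (w : F), @Eq F (fundamentalField H F X q') w →
      (⟨q, fundamentalField H F X q⟩ : TangentBundle 𝓘(ℝ, F) (G ⧸ H)) = ⟨q', w⟩ := by
    rintro _ rfl w rfl; rfl
  exact key _ hq _ (fundamentalField_cosetInv hM X (s q))

theorem mlieBracket_fundamentalField [CompleteSpace E] [CompleteSpace F]
    (hM : IsHomogeneousSpace E H F) (X Y : GroupLieAlgebra 𝓘(ℝ, E) G) (p : G ⧸ H) :
    mlieBracket 𝓘(ℝ, F) (fundamentalField H F X) (fundamentalField H F Y) p =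
      fundamentalField H F ⁅X, Y⁆ p := by
  obtain ⟨a, rfl⟩ := cosetInv_surjective H p
  have : IsManifold 𝓘(ℝ, E) 2 G := IsManifold.of_le (n := ∞) (by norm_cast)
  have : IsManifold 𝓘(ℝ, F) 2 (G ⧸ H) := IsManifold.of_le (n := ∞) (by norm_cast)
  have : LieGroup 𝓘(ℝ, E) (minSmoothness ℝ 3) G :=
    LieGroup.of_le (n := ∞) (by simp only [minSmoothness_of_isRCLikeNormedField]; norm_cast)
  have hX := fun Z => (contMDiff_infty_mulInvariantVectorField (G := G) (E := E) Z).mdifferentiable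
    (by simp) a
  have hN := fun Z => (contMDiff_fundamentalField hM Z).mdifferentiable (by simp) (cosetInv H a)
  have h := mfderiv_mlieBracket_of_related (f := cosetInv H) (x := a)
    ((contMDiff_cosetInv hM).contMDiffAt.of_le (by norm_cast))
    (hX X) (hX Y) (hN X) (hN Y)
    (Eventually.of_forall fun y => (fundamentalField_cosetInv hM X y).symm)
    (Eventually.of_forall fun y => (fundamentalField_cosetInv hM Y y).symm)
  rw [← h, ← mulInvariantVector_mlieBracket]
  exact (fundamentalField_cosetInv hM ⁅X, Y⁆ a).symm

end Quotient
end Fundamental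

/-! ### Invariant metrics on fundamental vector fields -/

section InvariantMetric

open VectorField Set Filter
open scoped Topology

variable {E : Type*} [NormedAddCommGroup E] [NormedSpace ℝ E]
  {G : Type*} [TopologicalSpace G] [ChartedSpace E G] [Group G]
  {H : Subgroup G}
  {F : Type*} [NormedAddCommGroup F] [NormedSpace ℝ F]
  [ChartedSpace F (G ⧸ H)] [LieGroup 𝓘(ℝ, E) ∞ G] [IsManifold 𝓘(ℝ, F) ∞ (G ⧸ H)]

theorem smul_cosetInv (a b : G) : a • cosetInv H b = cosetInv H (b * a⁻¹) := by
  simp only [cosetInv, mul_inv_rev, inv_inv]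
  rfl

theorem mdifferentiable_smul_quotient (hM : IsHomogeneousSpace E H F) (a : G) :
    MDifferentiable 𝓘(ℝ, F) 𝓘(ℝ, F) (fun y : G ⧸ H => a • y) := by
  intro p
  obtain ⟨b, rfl⟩ := cosetInv_surjective H p
  obtain ⟨s, hs, -, hsq⟩ := exists_section_cosetInv hM b
  have h1 : ContMDiffAt 𝓘(ℝ, F) 𝓘(ℝ, E) ∞ (fun q => s q * a⁻¹) (cosetInv H b) :=
    hs.mul contMDiffAt_const
  have h2 := ((contMDiff_cosetInv hM).contMDiffAt.comp (cosetInv H b) h1).mdifferentiableAt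
    (by simp)
  refine h2.congr_of_eventuallyEq ?_
  filter_upwards [hsq] with q hq
  simp only [Function.comp]
  rw [← smul_cosetInv, hq]

/-- The sign is that of inversion; it cancels whenever the metric is evaluated on two fundamental
fields. -/
theorem mfderiv_cosetInv_one (hM : IsHomogeneousSpace E H F) (Y : GroupLieAlgebra 𝓘(ℝ, E) G) :
    @Eq F (mfderiv 𝓘(ℝ, E) 𝓘(ℝ, F) (cosetInv H) 1 Y) (-(evalBase E H F Y : F)) := by
  have h1 := mfderiv_comp (I := 𝓘(ℝ, E)) (I' := 𝓘(ℝ, E)) (I'' := 𝓘(ℝ, F)) (1 : G)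
    (f := fun x : G => x⁻¹) (g := fun a : G => (a : G ⧸ H))
    (hM.contMDiff.mdifferentiable (by simp) _) (mdifferentiable_inv_group 1)
  have h2 : (mfderiv 𝓘(ℝ, E) 𝓘(ℝ, F) (fun a : G => (a : G ⧸ H)) (1⁻¹ : G) : E →L[ℝ] F) =
      evalBase E H F := mfderiv_congr_point inv_one
  have h3 := congrArg (fun L : E →L[ℝ] F => L Y) h1
  refine h3.trans ?_
  refine (congrArg (fun L : E →L[ℝ] F =>
    L (mfderiv 𝓘(ℝ, E) 𝓘(ℝ, E) (fun x : G => x⁻¹) 1 Y)) h2).trans ?_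
  refine (congrArg (fun L : E →L[ℝ] E => (evalBase E H F (L Y) : F)) mfderiv_inv_one).trans ?_
  exact map_neg (evalBase E H F) Y

theorem fundamentalField_base (hM : IsHomogeneousSpace E H F) (Y : GroupLieAlgebra 𝓘(ℝ, E) G) :
    @Eq F (fundamentalField H F Y ((1 : G) : G ⧸ H)) (-(evalBase E H F Y : F)) := by
  have h : ((1 : G) : G ⧸ H) = cosetInv H 1 := by simp [cosetInv]
  have key : ∀ q, q = cosetInv H 1 → @Eq F (fundamentalField H F Y q)
      (fundamentalField H F Y (cosetInv H 1)) := by rintro _ rfl; rfl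
  refine (key _ h).trans ((fundamentalField_cosetInv hM Y 1).trans ?_)
  refine Eq.trans ?_ (mfderiv_cosetInv_one hM Y)
  exact congrArg (mfderiv 𝓘(ℝ, E) 𝓘(ℝ, F) (cosetInv H) 1) (mulInvariantVectorField_one Y)

/-- Left translation by `a` moves the fundamental field at `a⁻¹H` to the base point. -/
theorem mfderiv_smul_fundamentalField (hM : IsHomogeneousSpace E H F)
    (Y : GroupLieAlgebra 𝓘(ℝ, E) G) (a : G) :
    @Eq F (mfderiv 𝓘(ℝ, F) 𝓘(ℝ, F) (fun y : G ⧸ H => a • y) (cosetInv H a)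
      (fundamentalField H F Y (cosetInv H a))) (-(evalBase E H F (adjointAction a Y) : F)) := by
  -- Both sides send $x$ to $ax^{-1}a^{-1}H$; the claim is the derivative of this identity at $x=1$.
  have hcomp : (fun y : G ⧸ H => a • y) ∘ (cosetInv H ∘ fun x : G => a * x) =
      cosetInv H ∘ (fun x : G => a * x * a⁻¹) := by
    ext x
    simp only [Function.comp]
    exact smul_cosetInv a (a * x)
  have hb : ∀ b, MDifferentiableAt 𝓘(ℝ, E) 𝓘(ℝ, F) (cosetInv H) b :=
    fun b => mdifferentiable_cosetInv hM b
  have hinner : MDifferentiableAt 𝓘(ℝ, E) 𝓘(ℝ, F) (cosetInv H ∘ fun x : G => a * x) 1 :=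
    (hb _).comp 1 (mdifferentiable_leftMul a 1)
  have h1 := mfderiv_congr (I := 𝓘(ℝ, E)) (I' := 𝓘(ℝ, F)) (x := (1 : G)) hcomp
  have h2 := mfderiv_comp (I := 𝓘(ℝ, E)) (I' := 𝓘(ℝ, F)) (I'' := 𝓘(ℝ, F)) (1 : G)
    (f := cosetInv H ∘ fun x : G => a * x) (g := fun y : G ⧸ H => a • y)
    (mdifferentiable_smul_quotient hM a _) hinner
  have h3 := mfderiv_comp (I := 𝓘(ℝ, E)) (I' := 𝓘(ℝ, E)) (I'' := 𝓘(ℝ, F)) (1 : G)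
    (f := fun x : G => a * x) (g := cosetInv H) (hb _) (mdifferentiable_leftMul a 1)
  have h4 := mfderiv_comp (I := 𝓘(ℝ, E)) (I' := 𝓘(ℝ, E)) (I'' := 𝓘(ℝ, F)) (1 : G)
    (f := fun x : G => a * x * a⁻¹) (g := cosetInv H) (hb _) (mdifferentiable_conj a 1)
  have p1 : (mfderiv 𝓘(ℝ, F) 𝓘(ℝ, F) (fun y : G ⧸ H => a • y) (cosetInv H (a * 1)) : F →L[ℝ] F) =
      mfderiv 𝓘(ℝ, F) 𝓘(ℝ, F) (fun y : G ⧸ H => a • y) (cosetInv H a) :=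
    mfderiv_congr_point (congrArg _ (mul_one a))
  have p2 : (mfderiv 𝓘(ℝ, E) 𝓘(ℝ, F) (cosetInv H) (a * 1) : E →L[ℝ] F) =
      mfderiv 𝓘(ℝ, E) 𝓘(ℝ, F) (cosetInv H) a := mfderiv_congr_point (mul_one a)
  have p3 : (mfderiv 𝓘(ℝ, E) 𝓘(ℝ, F) (cosetInv H) (a * 1 * a⁻¹) : E →L[ℝ] F) =
      mfderiv 𝓘(ℝ, E) 𝓘(ℝ, F) (cosetInv H) 1 := mfderiv_congr_point (by simp)
  have q3 : @Eq F (mfderiv 𝓘(ℝ, E) 𝓘(ℝ, F) (cosetInv H ∘ fun x : G => a * x) 1 Y)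
      (fundamentalField H F Y (cosetInv H a)) :=
    (congrArg (fun L : E →L[ℝ] F => L Y) h3).trans
      ((congrArg (fun L : E →L[ℝ] F => L (mulInvariantVectorField Y a)) p2).trans
        (fundamentalField_cosetInv hM Y a).symm)
  have q4 : @Eq F (mfderiv 𝓘(ℝ, E) 𝓘(ℝ, F) (cosetInv H ∘ fun x : G => a * x * a⁻¹) 1 Y)
      (-(evalBase E H F (adjointAction a Y) : F)) :=
    (congrArg (fun L : E →L[ℝ] F => L Y) h4).trans
      ((congrArg (fun L : E →L[ℝ] F => L (adjointAction a Y)) p3).trans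
        (mfderiv_cosetInv_one hM (adjointAction a Y)))
  have q2 := congrArg (fun L : E →L[ℝ] F => L Y) (h2.symm.trans h1)
  refine Eq.trans ?_ (q2.trans q4)
  refine (congrArg (fun w : F => mfderiv 𝓘(ℝ, F) 𝓘(ℝ, F) (fun y : G ⧸ H => a • y)
    (cosetInv H a) w) q3.symm).trans ?_
  exact (congrArg (fun L : F →L[ℝ] F => L
    (mfderiv 𝓘(ℝ, E) 𝓘(ℝ, F) (cosetInv H ∘ fun x : G => a * x) 1 Y)) p1).symm

variable [FiniteDimensional ℝ F]

/-- An invariant metric on fundamental fields is given by the metric at the base point and the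
adjoint representation. -/
theorem inner_fundamentalField (hM : IsHomogeneousSpace E H F) {g : SmoothMetric F (G ⧸ H)}
    (hg : IsInvariantMetric g) (Y Z : GroupLieAlgebra 𝓘(ℝ, E) G) (a : G) :
    g.inner (cosetInv H a) (fundamentalField H F Y (cosetInv H a))
      (fundamentalField H F Z (cosetInv H a)) =
      metricAtBase g (adjointAction a Y) (adjointAction a Z) := by
  rw [← hg a (cosetInv H a)]
  have h : a • cosetInv H a = ((1 : G) : G ⧸ H) := by
    rw [smul_cosetInv]; simp [cosetInv]
  have key : ∀ (q q' : G ⧸ H) (u v u' v' : F), q = q' → u = -u' → v = -v' →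
      g.inner q u v = g.inner q' u' v' := by
    rintro q _ _ _ u' v' rfl rfl rfl
    have h1 : g.inner q (-u' : F) (-v' : F) = - g.inner q (u' : F) (-v' : F) := by
      have := map_neg (g.inner q) u'
      exact congrArg (fun L => L (-v' : F)) this
    have h2 : g.inner q (u' : F) (-v' : F) = - g.inner q (u' : F) (v' : F) :=
      map_neg (g.inner q u') v'
    rw [h1, h2, neg_neg]
  exact key _ _ _ _ _ _ h (mfderiv_smul_fundamentalField hM Y a)
    (mfderiv_smul_fundamentalField hM Z a)

theorem mdifferentiableAt_inner {F : Type*} [NormedAddCommGroup F] [NormedSpace ℝ F]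
    [FiniteDimensional ℝ F]
    {M : Type*} [TopologicalSpace M] [ChartedSpace F M] [IsManifold 𝓘(ℝ, F) ∞ M]
    (g : SmoothMetric F M) {Y Z : Π p : M, TangentSpace 𝓘(ℝ, F) p} {p : M}
    (hY : MDiffAt (T% Y) p) (hZ : MDiffAt (T% Z) p) :
    MDifferentiableAt 𝓘(ℝ, F) 𝓘(ℝ, ℝ) (fun q => g.inner q (Y q) (Z q)) p := by
  have : MDifferentiableAt 𝓘(ℝ, F) (𝓘(ℝ, F).prod 𝓘(ℝ))
      (fun m ↦ TotalSpace.mk' ℝ (E := Bundle.Trivial M ℝ) m (g.inner m (Y m) (Z m))) p := by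
    apply MDifferentiableAt.clm_bundle_apply₂ (F₁ := F) (F₂ := F)
    · exact g.contMDiff.mdifferentiable (by simp) p
    · exact hY
    · exact hZ
  simp only [mdifferentiableAt_totalSpace] at this
  exact this.2

theorem hasMFDerivAt_prodMk_space {E : Type*} [NormedAddCommGroup E] [NormedSpace ℝ E]
    {N : Type*} [TopologicalSpace N] [ChartedSpace E N] {u v : N → E} {a : N} {u' v' : E →L[ℝ] E}
    (hu : HasMFDerivAt 𝓘(ℝ, E) 𝓘(ℝ, E) u a u') (hv : HasMFDerivAt 𝓘(ℝ, E) 𝓘(ℝ, E) v a v') :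
    HasMFDerivAt 𝓘(ℝ, E) 𝓘(ℝ, E × E) (fun b => (u b, v b)) a (u'.prod v') :=
  ⟨hu.1.prodMk hv.1, hu.2.prodMk hv.2⟩

/-- The product rule for a function which pulls back to a bilinear expression. -/
theorem mfderiv_of_comp_eq_bilinear {E F : Type*} [NormedAddCommGroup E] [NormedSpace ℝ E]
    [NormedAddCommGroup F] [NormedSpace ℝ F]
    {N : Type*} [TopologicalSpace N] [ChartedSpace E N]
    {M : Type*} [TopologicalSpace M] [ChartedSpace F M]
    {h : M → ℝ} {σ : N → M} {u v : N → E} (B : E →L[ℝ] E →L[ℝ] ℝ) {a : N}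
    (hh : MDifferentiableAt 𝓘(ℝ, F) 𝓘(ℝ, ℝ) h (σ a))
    (hσ : MDifferentiableAt 𝓘(ℝ, E) 𝓘(ℝ, F) σ a)
    (hu : MDifferentiableAt 𝓘(ℝ, E) 𝓘(ℝ, E) u a) (hv : MDifferentiableAt 𝓘(ℝ, E) 𝓘(ℝ, E) v a)
    (hcomp : ∀ b, h (σ b) = B (u b) (v b)) (w : E) :
    @Eq ℝ (mfderiv 𝓘(ℝ, F) 𝓘(ℝ, ℝ) h (σ a) (mfderiv 𝓘(ℝ, E) 𝓘(ℝ, F) σ a w))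
      (B (mfderiv 𝓘(ℝ, E) 𝓘(ℝ, E) u a w : E) (v a) +
        B (u a) (mfderiv 𝓘(ℝ, E) 𝓘(ℝ, E) v a w : E)) := by
  have e1 := hh.hasMFDerivAt.comp a hσ.hasMFDerivAt
  have hB : HasFDerivAt (fun z : E × E => B z.1 z.2) (B.deriv₂ (u a, v a)) (u a, v a) :=
    B.isBoundedBilinearMap.hasFDerivAt (u a, v a)
  have e2 := HasMFDerivAt.comp (f := fun b => (u b, v b)) a hB.hasMFDerivAt
    (hasMFDerivAt_prodMk_space hu.hasMFDerivAt hv.hasMFDerivAt)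
  have e3 := congrArg (fun L : E →L[ℝ] ℝ => L w) (hasMFDerivAt_unique
    (e1.congr_of_eventuallyEq (Filter.Eventually.of_forall fun b => (hcomp b).symm)) e2)
  exact e3.trans (add_comm _ _)

variable [FiniteDimensional ℝ E]

/-- The Lie derivative of an invariant metric along a fundamental field vanishes. -/
theorem mfderiv_inner_fundamentalField (hM : IsHomogeneousSpace E H F)
    {g : SmoothMetric F (G ⧸ H)} (hg : IsInvariantMetric g)
    (X Y Z : GroupLieAlgebra 𝓘(ℝ, E) G) (p : G ⧸ H) :
    @Eq ℝ (mfderiv 𝓘(ℝ, F) 𝓘(ℝ, ℝ)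
        (fun q => g.inner q (fundamentalField H F Y q) (fundamentalField H F Z q)) p
        (fundamentalField H F X p))
      (g.inner p (fundamentalField H F ⁅X, Y⁆ p) (fundamentalField H F Z p) +
        g.inner p (fundamentalField H F Y p) (fundamentalField H F ⁅X, Z⁆ p)) := by
  obtain ⟨a, rfl⟩ := cosetInv_surjective H p
  set h : G ⧸ H → ℝ := fun q => g.inner q (fundamentalField H F Y q) (fundamentalField H F Z q)
    with hh
  have hd : MDifferentiableAt 𝓘(ℝ, F) 𝓘(ℝ, ℝ) h (cosetInv H a) :=
    mdifferentiableAt_inner g ((contMDiff_fundamentalField hM Y).mdifferentiable (by simp) _)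
      ((contMDiff_fundamentalField hM Z).mdifferentiable (by simp) _)
  let T : E →L[ℝ] F := evalBase E H F
  let B₀ : F →L[ℝ] F →L[ℝ] ℝ := g.inner ((1 : G) : G ⧸ H)
  -- Pulled back to `G`, the inner product of two fundamental fields is
  -- $B(\mathrm{Ad}(a)Y,\mathrm{Ad}(a)Z)$, so its derivative along `X` comes from
  -- $d\,\mathrm{Ad}=\mathrm{ad}$.
  let B : E →L[ℝ] E →L[ℝ] ℝ := B₀.bilinearComp T T
  have e := mfderiv_of_comp_eq_bilinear B hd (mdifferentiable_cosetInv hM a)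
    (mdifferentiableAt_adjointOrbit Y a) (mdifferentiableAt_adjointOrbit Z a)
    (inner_fundamentalField hM hg Y Z) (mulInvariantVectorField X a)
  have key : ∀ w w' : F, w = w' → (mfderiv 𝓘(ℝ, F) 𝓘(ℝ, ℝ) h (cosetInv H a) w : ℝ) =
    mfderiv 𝓘(ℝ, F) 𝓘(ℝ, ℝ) h (cosetInv H a) w' := by rintro _ _ rfl; rfl
  have key2 : ∀ u u' v v' : E, u = u' → v = v' →
      B u (adjointOrbit Z a) + B (adjointOrbit Y a) v =
        B u' (adjointOrbit Z a) + B (adjointOrbit Y a) v' := by rintro _ _ _ _ rfl rfl; rfl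
  refine (key _ _ (fundamentalField_cosetInv hM X a)).trans (e.trans ((key2 _ _ _ _
    (mfderiv_adjointOrbit X Y a) (mfderiv_adjointOrbit X Z a)).trans ?_))
  exact congrArg₂ (· + ·) (inner_fundamentalField hM hg ⁅X, Y⁆ Z a).symm
    (inner_fundamentalField hM hg Y ⁅X, Z⁆ a).symm

end InvariantMetric

/-! ### The Levi-Civita connection on Killing fields -/

section Killing

open VectorField

variable {F : Type*} [NormedAddCommGroup F] [NormedSpace ℝ F] [FiniteDimensional ℝ F]
  {M : Type*} [TopologicalSpace M] [ChartedSpace F M] [IsManifold 𝓘(ℝ, F) ∞ M]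
  {L : Type*} [Bracket L L]

/-- A bracket-preserving family of smooth vector fields along which the Lie derivative of the
metric vanishes on the family. -/
structure IsKillingFamily (g : SmoothMetric F M)
    (N : L → Π p : M, TangentSpace 𝓘(ℝ, F) p) : Prop where
  smooth : ∀ X, CMDiff ∞ (T% (N X))
  bracket : ∀ X Y p, mlieBracket 𝓘(ℝ, F) (N X) (N Y) p = N ⁅X, Y⁆ p
  deriv : ∀ X Y Z p, mfderiv 𝓘(ℝ, F) 𝓘(ℝ, ℝ) (fun q => g.inner q (N Y q) (N Z q)) p (N X p) =
    g.inner p (N ⁅X, Y⁆ p) (N Z p) + g.inner p (N Y p) (N ⁅X, Z⁆ p)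

namespace IsKillingFamily

variable {g : SmoothMetric F M} {N : L → Π p : M, TangentSpace 𝓘(ℝ, F) p}
  {conn : AffineConnection F M}

theorem mdifferentiableAt (hN : IsKillingFamily g N) (X : L) (p : M) : MDiffAt (T% (N X)) p :=
  (hN.smooth X).mdifferentiable (by simp) p

theorem torsion (hN : IsKillingFamily g N) (hc : IsLeviCivita g conn) (X Y : L) (p : M) :
    conn (N Y) p (N X p) - conn (N X) p (N Y p) = N ⁅X, Y⁆ p := by
  rw [← hN.bracket]
  exact (CovariantDerivative.torsion_eq_zero_iff conn).1 hc.torsion_free (hN.mdifferentiableAt X p)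
    (hN.mdifferentiableAt Y p)

/-- Killing's equation: comparing the invariance of $g$ with metric compatibility, and replacing
brackets by the torsion-free formula, shows that $\nabla N_X$ is skew on values of the family. -/
theorem inner_skew (hN : IsKillingFamily g N) (hc : IsLeviCivita g conn) (X Y Z : L) (p : M) :
    g.inner p (conn (N X) p (N Y p)) (N Z p) = - g.inner p (N Y p) (conn (N X) p (N Z p)) := by
  have h2 : @Eq ℝ (g.inner p (N ⁅X, Y⁆ p) (N Z p) + g.inner p (N Y p) (N ⁅X, Z⁆ p))
      (g.inner p (conn (N Y) p (N X p)) (N Z p) + g.inner p (N Y p) (conn (N Z) p (N X p))) :=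
    (hN.deriv X Y Z p).symm.trans (hc.metric p (N X p) (N Y) (N Z) (hN.mdifferentiableAt Y p)
      (hN.mdifferentiableAt Z p))
  rw [← hN.torsion hc X Y p, ← hN.torsion hc X Z p] at h2
  simp only [map_sub, sub_apply] at h2
  linarith

theorem inner_conn_self (hN : IsKillingFamily g N) (hc : IsLeviCivita g conn) (X Y : L) (p : M) :
    g.inner p (conn (N X) p (N Y p)) (N Y p) = 0 := by
  have := hN.inner_skew hc X Y Y p
  rw [g.symm p (N Y p)] at this
  linarith

/-- Koszul's formula for Killing fields; no derivatives of inner products remain, so at a point the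
connection is algebraic. -/
theorem two_inner_conn (hN : IsKillingFamily g N) (hc : IsLeviCivita g conn) (X Y Z : L) (p : M) :
    2 * g.inner p (conn (N Y) p (N X p)) (N Z p) = g.inner p (N ⁅X, Y⁆ p) (N Z p) +
      g.inner p (N ⁅X, Z⁆ p) (N Y p) + g.inner p (N X p) (N ⁅Y, Z⁆ p) := by
  have k1 := hN.inner_skew hc Y X Z p
  have k2 := hN.inner_skew hc Z X Y p
  have k3 := hN.inner_skew hc X Z Y p
  rw [← hN.torsion hc X Y p, ← hN.torsion hc X Z p, ← hN.torsion hc Y Z p]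
  simp only [map_sub, sub_apply]
  have s1 := g.symm p (N Z p) (conn (N X) p (N Y p))
  have s2 := g.symm p (N Z p) (conn (N Y) p (N X p))
  linarith

theorem inner_conn_diag (hN : IsKillingFamily g N) (hc : IsLeviCivita g conn) (X Y : L) (p : M) :
    g.inner p (conn (N Y) p (N Y p)) (N X p) = - g.inner p (N Y p) (N ⁅X, Y⁆ p) := by
  rw [hN.inner_skew hc Y Y X p, ← hN.torsion hc X Y p, map_sub]
  have := hN.inner_conn_self hc X Y p
  rw [g.symm] at this
  rw [this, sub_zero]

theorem mdifferentiableAt_conn (hN : IsKillingFamily g N) (hc : IsLeviCivita g conn) (X Y : L)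
    (p : M) : MDiffAt (T% (fun q => conn (N Y) q (N X q))) p := by
  have h := hc.smooth.contMDiff.contMDiff (hN.smooth Y).contMDiffOn
  exact ((contMDiffOn_univ.1 h).clm_bundle_apply (hN.smooth X)).mdifferentiable (by simp) p

/-- The sectional curvature numerator of a plane spanned by two Killing fields. -/
theorem inner_curvature (hN : IsKillingFamily g N) (hc : IsLeviCivita g conn) (X Y : L) (p : M) :
    g.inner p (curvature conn (N X) (N Y) (N Y) p) (N X p) =
      g.inner p (conn (N Y) p (N X p)) (conn (N Y) p (N X p)) -
        g.inner p (conn (N X) p (N X p)) (conn (N Y) p (N Y p)) -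
        g.inner p (N ⁅X, Y⁆ p) (N ⁅X, Y⁆ p) - g.inner p (N ⁅X, ⁅X, Y⁆⁆ p) (N Y p) := by
  -- Metric compatibility moves the outer derivative in $\nabla_X\nabla_Y Y$ and $\nabla_Y\nabla_X
  -- Y$ onto functions that are known: $g(\nabla_Y Y,X)=-g(Y,[X,Y])$ and $g(\nabla_X Y,X)=0$.
  have m1 := hc.metric p (N X p) (fun q => conn (N Y) q (N Y q)) (N X)
    (hN.mdifferentiableAt_conn hc Y Y p) (hN.mdifferentiableAt X p)
  have m2 := hc.metric p (N Y p) (fun q => conn (N Y) q (N X q)) (N X)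
    (hN.mdifferentiableAt_conn hc X Y p) (hN.mdifferentiableAt X p)
  have f1 : (fun q => g.inner q (conn (N Y) q (N Y q)) (N X q)) =
      -fun q => g.inner q (N Y q) (N ⁅X, Y⁆ q) := funext fun q => hN.inner_conn_diag hc X Y q
  have f2 : (fun q => g.inner q (conn (N Y) q (N X q)) (N X q)) = fun _ => 0 :=
    funext fun q => hN.inner_conn_self hc Y X q
  rw [f1, mfderiv_neg] at m1
  rw [f2, mfderiv_const] at m2
  have d := hN.deriv X Y ⁅X, Y⁆ p
  have m1' : -(g.inner p (N ⁅X, Y⁆ p) (N ⁅X, Y⁆ p) + g.inner p (N Y p) (N ⁅X, ⁅X, Y⁆⁆ p)) = _ :=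
    (congrArg (fun t : ℝ => -t) d).symm.trans m1
  have m2' : (0 : ℝ) = _ := m2
  have k := hN.inner_skew hc Y ⁅X, Y⁆ X p
  have t := hN.torsion hc X Y p
  unfold curvature
  rw [hN.bracket]
  simp only [map_sub, sub_apply]
  rw [k]
  have t' : conn (N X) p (N Y p) = conn (N Y) p (N X p) - N ⁅X, Y⁆ p := by
    rw [← t, sub_sub_cancel]
  rw [t', map_sub] at m2'
  have s1 := g.symm p (N ⁅X, Y⁆ p) (conn (N Y) p (N X p))
  have s2 := g.symm p (N Y p) (N ⁅X, ⁅X, Y⁆⁆ p)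
  have s3 := g.symm p (conn (N X) p (N X p)) (conn (N Y) p (N Y p))
  linarith

end IsKillingFamily

end Killing

/-! ### Fundamental fields are Killing for invariant metrics -/

section Invariant

variable {E : Type*} [NormedAddCommGroup E] [NormedSpace ℝ E] [FiniteDimensional ℝ E]
  {G : Type*} [TopologicalSpace G] [ChartedSpace E G] [Group G]
  {H : Subgroup G}
  {F : Type*} [NormedAddCommGroup F] [NormedSpace ℝ F] [FiniteDimensional ℝ F]
  [ChartedSpace F (G ⧸ H)] [LieGroup 𝓘(ℝ, E) ∞ G] [IsManifold 𝓘(ℝ, F) ∞ (G ⧸ H)]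

theorem isKillingFamily_fundamentalField (hM : IsHomogeneousSpace E H F)
    {g : SmoothMetric F (G ⧸ H)} (hg : IsInvariantMetric g) :
    IsKillingFamily g (fun X : GroupLieAlgebra 𝓘(ℝ, E) G => fundamentalField H F X) :=
  ⟨contMDiff_fundamentalField hM, mlieBracket_fundamentalField hM,
    mfderiv_inner_fundamentalField hM hg⟩

end Invariant

/-! ### Orthonormal bases of bilinear forms -/

section OrthonormalBasis

variable {V : Type*} [AddCommGroup V] [Module ℝ V] {ι : Type*} [Fintype ι] [DecidableEq ι]
  {B : LinearMap.BilinForm ℝ V} {b : Module.Basis ι ℝ V}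

theorem repr_eq_of_orthonormal (hb : ∀ i j, B (b i) (b j) = if i = j then 1 else 0) (x : V)
    (i : ι) : b.repr x i = B x (b i) := by
  conv_rhs => rw [← b.sum_repr x]
  simp only [map_sum, map_smul, LinearMap.sum_apply, LinearMap.smul_apply, hb]
  simp

theorem sum_smul_of_orthonormal (hb : ∀ i j, B (b i) (b j) = if i = j then 1 else 0) (x : V) :
    ∑ i, B x (b i) • b i = x := by
  conv_rhs => rw [← b.sum_repr x]
  simp [repr_eq_of_orthonormal hb]

theorem parseval_of_orthonormal (hb : ∀ i j, B (b i) (b j) = if i = j then 1 else 0) (x y : V) :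
    B x y = ∑ i, B x (b i) * B y (b i) := by
  conv_lhs => rw [← sum_smul_of_orthonormal hb y]
  simp [map_sum, mul_comm]

/-- The left side does not involve `B`: this allows passing from a $g$-orthonormal to a
$Q$-orthonormal basis. -/
theorem trace_eq_of_orthonormal (hb : ∀ i j, B (b i) (b j) = if i = j then 1 else 0)
    (T : V →ₗ[ℝ] V) : LinearMap.trace ℝ V T = ∑ i, B (T (b i)) (b i) := by
  rw [LinearMap.trace_eq_matrix_trace ℝ b, Matrix.trace]
  simp [LinearMap.toMatrix_apply, repr_eq_of_orthonormal hb]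

theorem trace_comp_self_of_orthonormal (hb : ∀ i j, B (b i) (b j) = if i = j then 1 else 0)
    (T : V →ₗ[ℝ] V) :
    LinearMap.trace ℝ V (T ∘ₗ T) = ∑ i, ∑ j, B (T (b i)) (b j) * B (T (b j)) (b i) := by
  rw [trace_eq_of_orthonormal hb]
  refine Finset.sum_congr rfl fun i _ => ?_
  rw [LinearMap.comp_apply]
  conv_lhs => rw [← sum_smul_of_orthonormal hb (T (b i))]
  simp [map_sum, LinearMap.sum_apply]

theorem exists_orthonormal_basis [FiniteDimensional ℝ V] (hs : ∀ x y, B x y = B y x)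
    (hp : ∀ x, x ≠ 0 → 0 < B x x) :
    ∃ e : Module.Basis (Fin (Module.finrank ℝ V)) ℝ V,
      ∀ i j, B (e i) (e j) = if i = j then 1 else 0 := by
  obtain ⟨v, hv⟩ := LinearMap.BilinForm.exists_orthogonal_basis (B := B) ⟨hs⟩
  have hpos : ∀ i, 0 < B (v i) (v i) := fun i => hp _ (v.ne_zero i)
  have hunit : ∀ i, IsUnit (Real.sqrt (B (v i) (v i)))⁻¹ := fun i =>
    (inv_ne_zero (Real.sqrt_pos.2 (hpos i)).ne').isUnit
  refine ⟨v.isUnitSMul hunit, fun i j => ?_⟩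
  simp only [Module.Basis.isUnitSMul_apply, map_smul, LinearMap.smul_apply, smul_eq_mul]
  split_ifs with h
  · subst h
    have := Real.mul_self_sqrt (hpos i).le
    have h0 := (Real.sqrt_pos.2 (hpos i)).ne'
    field_simp
    nlinarith
  · have : B (v i) (v j) = 0 := hv h
    rw [this]; simp

/-- A symmetric form is bounded below by its smallest eigenvalue relative to an inner product. -/
theorem le_of_le_eigenvalues [FiniteDimensional ℝ V] (hs : ∀ x y, B x y = B y x)
    (hp : ∀ x, x ≠ 0 → 0 < B x x) {φ : LinearMap.BilinForm ℝ V} (hφ : ∀ x y, φ x y = φ y x)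
    {c : ℝ} (h : ∀ l : ℝ, ∀ x : V, x ≠ 0 → (∀ y, φ x y = l * B x y) → c ≤ l) (x : V) :
    c * B x x ≤ φ x x := by
  obtain ⟨e, he⟩ := exists_orthonormal_basis hs hp
  -- The matrix of `φ - c B` in a `B`-orthonormal basis. An eigenvalue $\lambda$ of it gives the
  -- eigenvalue $\lambda+c$ of `φ` relative to `B`, so $\lambda\ge 0$ and the matrix is positive
  -- semidefinite.
  let A : Matrix (Fin (Module.finrank ℝ V)) (Fin (Module.finrank ℝ V)) ℝ :=
    Matrix.of fun i j => φ (e i) (e j) - c * B (e i) (e j)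
  have hA : A.IsHermitian := by
    ext i j
    simp [A, hφ (e j), hs (e j)]
  have hmul : ∀ v : Fin (Module.finrank ℝ V) → ℝ, ∀ i, A.mulVec v i =
      φ (∑ j, v j • e j) (e i) - c * B (∑ j, v j • e j) (e i) := by
    intro v i
    simp only [Matrix.mulVec, dotProduct, A, Matrix.of_apply, map_sum, map_smul,
      LinearMap.sum_apply, LinearMap.smul_apply, smul_eq_mul, Finset.mul_sum,
      ← Finset.sum_sub_distrib]
    refine Finset.sum_congr rfl fun j _ => ?_
    rw [hφ (e j), hs (e j)]; ring
  have hpsd : A.PosSemidef := by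
    rw [hA.posSemidef_iff_eigenvalues_nonneg]
    intro k
    have hev := hA.mulVec_eigenvectorBasis k
    set v : Fin (Module.finrank ℝ V) → ℝ := ⇑(hA.eigenvectorBasis k) with hv
    have hne : (∑ j, v j • e j) ≠ 0 := by
      intro h0
      have hz : ∀ j, v j = 0 := Fintype.linearIndependent_iff.1 e.linearIndependent v h0
      exact hA.eigenvectorBasis.toBasis.ne_zero k (by
        ext j
        simpa using hz j)
    have hl := h (hA.eigenvalues k + c) _ hne (fun y => by
      conv_lhs => rw [← sum_smul_of_orthonormal he y]
      conv_rhs => rw [← sum_smul_of_orthonormal he y]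
      have h2 : ∀ i, B (∑ j, v j • e j) (e i) = v i := fun i => by
        simp [map_sum, LinearMap.sum_apply, he]
      have h3 : ∀ i, φ (∑ j, v j • e j) (e i) = hA.eigenvalues k * v i + c * v i := fun i => by
        have h1 := congrFun hev i
        rw [hmul, h2] at h1
        simp only [Pi.smul_apply, smul_eq_mul] at h1
        linarith
      generalize ∑ j, v j • e j = X at h2 h3
      simp only [map_sum, map_smul, smul_eq_mul, Finset.mul_sum, h2, h3]
      exact Finset.sum_congr rfl fun i _ => by ring)
    simpa using hl
  have hx := hpsd.dotProduct_mulVec_nonneg (fun i => B x (e i))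
  simp only [star_trivial, dotProduct, hmul, sum_smul_of_orthonormal he] at hx
  have e1 : φ x x = ∑ i, B x (e i) * φ x (e i) := by
    conv_lhs => enter [2]; rw [← sum_smul_of_orthonormal he x]
    simp [map_sum]
  rw [e1, parseval_of_orthonormal he x x, Finset.mul_sum, ← sub_nonneg, ← Finset.sum_sub_distrib]
  refine hx.trans_eq (Finset.sum_congr rfl fun i _ => by ring)

/-- A bilinear operation on a finite-dimensional Euclidean space is bounded. -/
theorem exists_bilinear_bound [FiniteDimensional ℝ V] (hs : ∀ x y, B x y = B y x)
    (hp : ∀ x, x ≠ 0 → 0 < B x x) (β : V →ₗ[ℝ] V →ₗ[ℝ] V) :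
    ∃ κ : ℝ, 0 ≤ κ ∧ ∀ x y, B (β x y) (β x y) ≤ κ * (B x x * B y y) := by
  obtain ⟨e, he⟩ := exists_orthonormal_basis hs hp
  -- The constant is the squared Hilbert–Schmidt norm of `β`; the bound is Cauchy–Schwarz in each
  -- output coordinate.
  refine ⟨∑ k, ∑ p : Fin (Module.finrank ℝ V) × Fin (Module.finrank ℝ V),
    B (β (e p.1) (e p.2)) (e k) ^ 2, by positivity, fun x y => ?_⟩
  rw [parseval_of_orthonormal he, Finset.sum_mul]
  refine Finset.sum_le_sum fun k _ => ?_
  have h1 : B (β x y) (e k) = ∑ p : Fin (Module.finrank ℝ V) × Fin (Module.finrank ℝ V),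
      B (β (e p.1) (e p.2)) (e k) * (B x (e p.1) * B y (e p.2)) := by
    conv_lhs => rw [← sum_smul_of_orthonormal he x, ← sum_smul_of_orthonormal he y]
    simp only [map_sum, map_smul, LinearMap.sum_apply, LinearMap.smul_apply, smul_eq_mul,
      Fintype.sum_prod_type, Finset.mul_sum]
    rw [Finset.sum_comm]
    refine Finset.sum_congr rfl fun i _ => Finset.sum_congr rfl fun j _ => by ring
  have h2 : B x x * B y y = ∑ p : Fin (Module.finrank ℝ V) × Fin (Module.finrank ℝ V),
      (B x (e p.1) * B y (e p.2)) ^ 2 := by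
    rw [parseval_of_orthonormal he x x, parseval_of_orthonormal he y y, Finset.sum_mul_sum,
      Fintype.sum_prod_type]
    refine Finset.sum_congr rfl fun i _ => Finset.sum_congr rfl fun j _ => by ring
  rw [← sq, h1, h2]
  exact Finset.sum_mul_sq_le_sq_mul_sq _ _ _

end OrthonormalBasis

/-! ### The algebraic estimate -/

section Algebra

/-- The total of the curvature expressions of structure constants. -/
theorem sum_curvature_structure_constants {ι : Type*} [Fintype ι] (c : ι → ι → ι → ℝ)
    (D : ι → ι → ℝ) (hc : ∀ i j k, c j i k = -c i j k) (htr : ∀ i, ∑ k, c i k k = 0) :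
    ∑ i, ∑ j, (∑ k, ((c i j k + c i k j + c j k i) / 2) ^ 2 -
        ∑ k, (c i i k + c i k i + c i k i) / 2 * ((c j j k + c j k j + c j k j) / 2) -
        ∑ k, c i j k ^ 2 - D i j) =
      -(∑ i, ∑ j, ∑ k, c i j k ^ 2) / 4 + (∑ i, ∑ j, ∑ k, c i j k * c i k j) / 2 -
        ∑ i, ∑ j, D i j := by
  have h0 : ∀ i k, c i i k = 0 := fun i k => by have := hc i i k; linarith
  -- The $\nabla_{f_i}f_i$ terms reduce to $c_{kii}c_{kjj}$, and the sum over $j$ is a vanishing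
  -- trace.
  have hmid : ∑ i, ∑ j, ∑ k, (c i i k + c i k i + c i k i) / 2 *
      ((c j j k + c j k j + c j k j) / 2) = 0 := by
    have h1 : ∀ i j k, (c i i k + c i k i + c i k i) / 2 * ((c j j k + c j k j + c j k j) / 2) =
        c k i i * c k j j := fun i j k => by
      rw [h0, h0, hc k i, hc k j]; ring
    simp only [h1]
    refine Finset.sum_eq_zero fun i _ => ?_
    rw [Finset.sum_comm]
    refine Finset.sum_eq_zero fun k _ => ?_
    rw [← Finset.mul_sum, htr, mul_zero]
  -- After relabelling, the three squares have equal sums and the three cross terms agree up to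
  -- signs $+,-,+$: the total is $\tfrac34\sum c_{ijk}^2+\tfrac12\sum c_{ijk}c_{ikj}$.
  have hsq : ∑ i, ∑ j, ∑ k, ((c i j k + c i k j + c j k i) / 2) ^ 2 =
      (∑ i, ∑ j, ∑ k, c i j k ^ 2 + ∑ i, ∑ j, ∑ k, c i k j ^ 2 + ∑ i, ∑ j, ∑ k, c j k i ^ 2) / 4 +
      (∑ i, ∑ j, ∑ k, c i j k * c i k j - ∑ i, ∑ j, ∑ k, c j i k * c j k i +
        ∑ i, ∑ j, ∑ k, c k i j * c k j i) / 2 := by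
    simp only [← Finset.sum_add_distrib, ← Finset.sum_sub_distrib, Finset.sum_div]
    refine Finset.sum_congr rfl fun i _ => Finset.sum_congr rfl fun j _ =>
      Finset.sum_congr rfl fun k _ => ?_
    rw [hc i j k, hc i k j, hc j k i]; ring
  have s1 : ∑ i, ∑ j, ∑ k, c i k j ^ 2 = ∑ i, ∑ j, ∑ k, c i j k ^ 2 :=
    Finset.sum_congr rfl fun i _ => Finset.sum_comm
  have s2 : ∑ i, ∑ j, ∑ k, c j k i ^ 2 = ∑ i, ∑ j, ∑ k, c i j k ^ 2 := by
    rw [Finset.sum_comm]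
    exact Finset.sum_congr rfl fun i _ => Finset.sum_comm
  have s3 : ∑ i, ∑ j, ∑ k, c j i k * c j k i = ∑ i, ∑ j, ∑ k, c i j k * c i k j :=
    Finset.sum_comm
  have s4 : ∑ i, ∑ j, ∑ k, c k i j * c k j i = ∑ i, ∑ j, ∑ k, c i j k * c i k j := by
    rw [← s3]
    exact Finset.sum_congr rfl fun i _ => Finset.sum_comm
  simp only [Finset.sum_sub_distrib]
  rw [hsq, hmid, s1, s2, s3, s4]
  ring

variable {V : Type*} [LieRing V] [LieAlgebra ℝ V] {m : Submodule ℝ V} [FiniteDimensional ℝ m]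
  {ι : Type*} [Fintype ι] [DecidableEq ι]

/-- Here `φ` plays the role of $g$, extended by zero on $\mathfrak h$, and `hK` bounds the curvature
expressions. Since `pr` is compatible with both forms, the traces of `pr ∘ ad` and `pr ∘ ad ∘ ad` on
`m` can be computed with either. -/
theorem sum_bracket_estimate {Q φ : LinearMap.BilinForm ℝ V} (hQs : ∀ x y, Q x y = Q y x)
    (hQp : ∀ x, x ≠ 0 → 0 < Q x x) (hQad : ∀ x y z : V, Q ⁅x, y⁆ z = -Q y ⁅x, z⁆)
    (pr : V →ₗ[ℝ] m) (hprQ : ∀ (x : V) (y : m), Q (pr x) y = Q x y)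
    (hprφ : ∀ (x : V) (y : m), φ (pr x) y = φ x y) (hle : ∀ x : m, Q x x ≤ φ x x)
    {κ : ℝ} (hκ0 : 0 ≤ κ) (hκ : ∀ x y : V, Q ⁅x, y⁆ ⁅x, y⁆ ≤ κ * (Q x x * Q y y))
    {b : Module.Basis ι ℝ m} (hb : ∀ i j, φ (b i) (b j) = if i = j then 1 else 0) {C : ℝ}
    (hK : ∀ i j, |∑ k, ((φ ⁅(b i : V), (b j : V)⁆ (b k) + φ ⁅(b i : V), (b k : V)⁆ (b j) +
          φ ⁅(b j : V), (b k : V)⁆ (b i)) / 2) ^ 2 -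
        ∑ k, (φ ⁅(b i : V), (b i : V)⁆ (b k) + φ ⁅(b i : V), (b k : V)⁆ (b i) +
            φ ⁅(b i : V), (b k : V)⁆ (b i)) / 2 *
          ((φ ⁅(b j : V), (b j : V)⁆ (b k) + φ ⁅(b j : V), (b k : V)⁆ (b j) +
            φ ⁅(b j : V), (b k : V)⁆ (b j)) / 2) -
        ∑ k, φ ⁅(b i : V), (b j : V)⁆ (b k) ^ 2 -
        φ ⁅(b i : V), ⁅(b i : V), (b j : V)⁆⁆ (b j)| ≤ C) :
    ∑ i, ∑ j, ∑ k, φ ⁅(b i : V), (b j : V)⁆ (b k) ^ 2 ≤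
      4 * (Fintype.card ι ^ 2 * C + Fintype.card ι * (Module.finrank ℝ m * κ)) := by
  have hb' : ∀ i j, φ.restrict m (b i) (b j) = if i = j then 1 else 0 := hb
  obtain ⟨e, he⟩ := exists_orthonormal_basis (B := Q.restrict m) (fun x y => hQs x y)
    (fun x hx => hQp x (by simpa using hx))
  let T : V → m →ₗ[ℝ] m := fun x => pr ∘ₗ (LieAlgebra.ad ℝ V x : V →ₗ[ℝ] V) ∘ₗ m.subtype
  have hTφ : ∀ x (y z : m), φ.restrict m (T x y) z = φ ⁅x, (y : V)⁆ z := fun x y z => hprφ _ z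
  have hTQ : ∀ x (y z : m), Q.restrict m (T x y) z = Q ⁅x, (y : V)⁆ z := fun x y z => hprQ _ z
  -- A trace of a $Q$-skew endomorphism.
  have htr : ∀ i, ∑ k, φ ⁅(b i : V), (b k : V)⁆ (b k) = 0 := fun i => by
    have h1 := trace_eq_of_orthonormal hb' (T (b i))
    rw [trace_eq_of_orthonormal he] at h1
    simp only [hTφ, hTQ] at h1
    rw [← h1]
    refine Finset.sum_eq_zero fun k _ => ?_
    have := hQad (b i) (e k) (e k)
    rw [hQs (e k)] at this
    linarith
  -- The trace of the square of a $Q$-skew endomorphism is minus a sum of squares.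
  have hP : ∀ i, ∑ j, ∑ k, φ ⁅(b i : V), (b j : V)⁆ (b k) * φ ⁅(b i : V), (b k : V)⁆ (b j) ≤ 0 :=
    fun i => by
      have h1 := trace_comp_self_of_orthonormal hb' (T (b i))
      rw [trace_comp_self_of_orthonormal he] at h1
      simp only [hTφ, hTQ] at h1
      rw [← h1]
      refine Finset.sum_nonpos fun j _ => Finset.sum_nonpos fun k _ => ?_
      have := hQad (b i) (e k) (e j)
      rw [hQs (e k)] at this
      rw [this]
      nlinarith [sq_nonneg (Q ⁅(b i : V), (e j : V)⁆ (e k))]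
  -- By skewness this is $\sum_k|[b_i,e_k]|_Q^2$ for a $Q$-orthonormal basis $(e_k)$; each term is
  -- at most $\kappa$ because $Q(b_i,b_i)\le\varphi(b_i,b_i)=1$.
  have hD : ∀ i, -∑ j, φ ⁅(b i : V), ⁅(b i : V), (b j : V)⁆⁆ (b j) ≤ Module.finrank ℝ m * κ :=
    fun i => by
      let A : m →ₗ[ℝ] m := pr ∘ₗ (LieAlgebra.ad ℝ V (b i) : V →ₗ[ℝ] V) ∘ₗ
        (LieAlgebra.ad ℝ V (b i) : V →ₗ[ℝ] V) ∘ₗ m.subtype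
      have hAφ : ∀ (y z : m), φ.restrict m (A y) z = φ ⁅(b i : V), ⁅(b i : V), (y : V)⁆⁆ z :=
        fun y z => hprφ _ z
      have hAQ : ∀ (y z : m), Q.restrict m (A y) z = Q ⁅(b i : V), ⁅(b i : V), (y : V)⁆⁆ z :=
        fun y z => hprQ _ z
      have h1 := trace_eq_of_orthonormal hb' A
      rw [trace_eq_of_orthonormal he] at h1
      simp only [hAφ, hAQ] at h1
      rw [← h1, ← Finset.sum_neg_distrib]
      have h2 : ∀ k, -Q ⁅(b i : V), ⁅(b i : V), (e k : V)⁆⁆ (e k) ≤ κ := fun k => by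
        rw [hQad, neg_neg]
        refine (hκ _ _).trans ?_
        have h3 : Q (e k) (e k) = 1 := by simpa using he k k
        have h4 : Q (b i) (b i) ≤ 1 := by simpa [hb i i] using hle (b i)
        rw [h3, mul_one]
        exact mul_le_of_le_one_right hκ0 h4
      refine (Finset.sum_le_sum fun k _ => h2 k).trans ?_
      simp
  have hsum := sum_curvature_structure_constants
    (fun i j k => φ ⁅(b i : V), (b j : V)⁆ (b k))
    (fun i j => φ ⁅(b i : V), ⁅(b i : V), (b j : V)⁆⁆ (b j))
    (fun i j k => by rw [← lie_skew, map_neg, LinearMap.neg_apply]) htr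
  have hlow : -(Fintype.card ι ^ 2 * C : ℝ) ≤ ∑ i : ι, ∑ j : ι, _ :=
    (show -(Fintype.card ι ^ 2 * C : ℝ) ≤ ∑ i : ι, ∑ j : ι, -C by simp; ring_nf; rfl).trans
      (Finset.sum_le_sum fun i _ => Finset.sum_le_sum fun j _ => (abs_le.1 (hK i j)).1)
  rw [hsum] at hlow
  have hP' := Finset.sum_nonpos fun i (_ : i ∈ Finset.univ) => hP i
  have hD' := Finset.sum_le_sum fun i (_ : i ∈ Finset.univ) => hD i
  simp only [Finset.sum_neg_distrib, Finset.sum_const, Finset.card_univ, nsmul_eq_mul] at hD'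
  linarith

end Algebra

/-! ### The estimate for an invariant metric -/

section Estimate

open Filter
open scoped Topology

variable {E : Type*} [NormedAddCommGroup E] [NormedSpace ℝ E]
  {G : Type*} [TopologicalSpace G] [ChartedSpace E G] [Group G]
  {H : Subgroup G}
  {F : Type*} [NormedAddCommGroup F] [NormedSpace ℝ F]
  [ChartedSpace F (G ⧸ H)] [LieGroup 𝓘(ℝ, E) ∞ G] [IsManifold 𝓘(ℝ, F) ∞ (G ⧸ H)]

theorem evalBase_surjective (hM : IsHomogeneousSpace E H F) :
    Function.Surjective (evalBase E H F) := by
  intro v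
  obtain ⟨s, hs, hs1, hsq⟩ := exists_section_cosetInv hM (1 : G)
  have hsd := hs.mdifferentiableAt (by simp)
  have h1 := mfderiv_comp (I := 𝓘(ℝ, F)) (I' := 𝓘(ℝ, E)) (I'' := 𝓘(ℝ, F)) (cosetInv H 1)
    (f := s) (g := cosetInv H) (mdifferentiable_cosetInv hM _) hsd
  have h2 : mfderiv 𝓘(ℝ, F) 𝓘(ℝ, F) (cosetInv H ∘ s) (cosetInv H 1) =
      mfderiv 𝓘(ℝ, F) 𝓘(ℝ, F) (id : G ⧸ H → G ⧸ H) (cosetInv H 1) :=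
    Filter.EventuallyEq.mfderiv_eq hsq
  have h3 : (mfderiv 𝓘(ℝ, F) 𝓘(ℝ, F) (cosetInv H ∘ s) (cosetInv H 1) : F →L[ℝ] F) =
      ContinuousLinearMap.id ℝ F := h2.trans mfderiv_id
  have h4 : (mfderiv 𝓘(ℝ, E) 𝓘(ℝ, F) (cosetInv H) (s (cosetInv H 1)) : E →L[ℝ] F) =
      mfderiv 𝓘(ℝ, E) 𝓘(ℝ, F) (cosetInv H) 1 := mfderiv_congr_point hs1
  let w : E := mfderiv 𝓘(ℝ, F) 𝓘(ℝ, E) s (cosetInv H 1) (v : F)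
  have h5 : @Eq F (mfderiv 𝓘(ℝ, E) 𝓘(ℝ, F) (cosetInv H) 1 w) v :=
    (congrArg (fun L : E →L[ℝ] F => L w) h4).symm.trans
      (congrArg (fun L : F →L[ℝ] F => L v) (h1.symm.trans h3))
  exact ⟨-w, (map_neg (evalBase E H F) w).trans ((mfderiv_cosetInv_one hM w).symm.trans h5)⟩

/-- Differentiate the constant function $a\mapsto Q(\mathrm{Ad}(a)Y,\mathrm{Ad}(a)Z)$ at the unit.
-/
theorem adInvariant_skew [FiniteDimensional ℝ E] (Q : AdInvariantInnerProduct (E := E) G)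
    (X Y Z : GroupLieAlgebra 𝓘(ℝ, E) G) : Q.form ⁅X, Y⁆ Z = -Q.form Y ⁅X, Z⁆ := by
  let B : E →L[ℝ] E →L[ℝ] ℝ := LinearMap.toContinuousBilinearMap (E := E) (F := E) Q.form
  have e := mfderiv_of_comp_eq_bilinear (h := fun _ : G => Q.form Y Z) (σ := fun x : G => x) B
    (a := (1 : G)) mdifferentiableAt_const mdifferentiableAt_id
    (mdifferentiableAt_adjointOrbit Y 1) (mdifferentiableAt_adjointOrbit Z 1)
    (fun b => (Q.ad_invariant b Y Z).symm) (mulInvariantVectorField X (1 : G))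
  have z : @Eq ℝ (mfderiv 𝓘(ℝ, E) 𝓘(ℝ, ℝ) (fun _ : G => Q.form Y Z) 1
      (mfderiv 𝓘(ℝ, E) 𝓘(ℝ, E) (fun x : G => x) 1 (mulInvariantVectorField X (1 : G)))) 0 := by
    rw [mfderiv_const]; rfl
  have key : ∀ u u' v v' s s' t t' : E, u = u' → v = v' → s = s' → t = t' →
      B u v + B s t = B u' v' + B s' t' := by rintro _ _ _ _ _ _ _ _ rfl rfl rfl rfl; rfl
  have e' := z.symm.trans (e.trans (key _ _ _ _ _ _ _ _
    ((mfderiv_adjointOrbit X Y 1).trans (adjointOrbit_one ⁅X, Y⁆)) (adjointOrbit_one Z)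
    (adjointOrbit_one Y) ((mfderiv_adjointOrbit X Z 1).trans (adjointOrbit_one ⁅X, Z⁆))))
  exact eq_neg_of_add_eq_zero_left e'.symm

variable [FiniteDimensional ℝ F]

variable (E) in
/-- The form `metricAtBase g` as a bilinear form. -/
def metricForm (g : SmoothMetric F (G ⧸ H)) :
    LinearMap.BilinForm ℝ (GroupLieAlgebra 𝓘(ℝ, E) G) :=
  LinearMap.mk₂ ℝ (metricAtBase g) (fun X X' Y => by simp [metricAtBase])
    (fun c X Y => by simp [metricAtBase]) (fun X Y Y' => by simp [metricAtBase])
    (fun c X Y => by simp [metricAtBase])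

theorem metricForm_apply (g : SmoothMetric F (G ⧸ H)) (X Y : GroupLieAlgebra 𝓘(ℝ, E) G) :
    metricForm E g X Y = metricAtBase g X Y := rfl

theorem metricForm_symm (g : SmoothMetric F (G ⧸ H)) (X Y : GroupLieAlgebra 𝓘(ℝ, E) G) :
    metricForm E g X Y = metricForm E g Y X := g.symm _ _ _

theorem metricForm_eq_zero (g : SmoothMetric F (G ⧸ H)) {X : GroupLieAlgebra 𝓘(ℝ, E) G}
    (hX : X ∈ isotropyAlgebra E H F) (Y : GroupLieAlgebra 𝓘(ℝ, E) G) :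
    metricForm E g X Y = 0 := by
  have h : evalBase E H F X = 0 := hX
  simp [metricForm_apply, metricAtBase, h]

theorem inner_fundamentalField_base (hM : IsHomogeneousSpace E H F) (g : SmoothMetric F (G ⧸ H))
    (Y Z : GroupLieAlgebra 𝓘(ℝ, E) G) :
    g.inner ((1 : G) : G ⧸ H) (fundamentalField H F Y ((1 : G) : G ⧸ H))
      (fundamentalField H F Z ((1 : G) : G ⧸ H)) = metricForm E g Y Z := by
  have hY : fundamentalField H F Y ((1 : G) : G ⧸ H) = -evalBase E H F Y :=
    fundamentalField_base hM Y
  have hZ : fundamentalField H F Z ((1 : G) : G ⧸ H) = -evalBase E H F Z :=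
    fundamentalField_base hM Z
  rw [hY, hZ]
  simp [metricForm_apply, metricAtBase]

variable [FiniteDimensional ℝ E] (Q : AdInvariantInnerProduct (E := E) G)
  {ι : Type*} [Fintype ι] [DecidableEq ι]

theorem sub_projComplement_mem (X : GroupLieAlgebra 𝓘(ℝ, E) G) :
    X - projComplement H F Q X ∈ isotropyAlgebra E H F := by
  have h := Submodule.projection_add_projection_eq_self
    (isCompl_isotropy_complement H (F := F) Q) X
  rw [← eq_sub_iff_add_eq] at h
  exact h ▸ Submodule.projection_apply_mem _ _

/-- Parseval: $\mathfrak m$ maps onto the tangent space at $eH$, and there the fundamental fields of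
`b` are, up to sign, the images of `b`. -/
theorem inner_base_eq_sum (hM : IsHomogeneousSpace E H F) (g : SmoothMetric F (G ⧸ H))
    {b : Module.Basis ι ℝ (complementSpace H F Q)} (hb : IsMetricOrthonormal Q g b)
    (u v : TangentSpace 𝓘(ℝ, F) ((1 : G) : G ⧸ H)) :
    g.inner ((1 : G) : G ⧸ H) u v =
      ∑ k, g.inner ((1 : G) : G ⧸ H) u (fundamentalField H F (b k).1 ((1 : G) : G ⧸ H)) *
        g.inner ((1 : G) : G ⧸ H) v (fundamentalField H F (b k).1 ((1 : G) : G ⧸ H)) := by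
  have hN : ∀ k, fundamentalField H F (b k).1 ((1 : G) : G ⧸ H) = -evalBase E H F (b k).1 :=
    fun k => fundamentalField_base hM (b k).1
  have hex : ∀ u : TangentSpace 𝓘(ℝ, F) ((1 : G) : G ⧸ H),
      ∃ x : complementSpace H F Q, evalBase E H F x.1 = u := fun u => by
    obtain ⟨X, rfl⟩ := evalBase_surjective hM u
    refine ⟨⟨projComplement H F Q X, Submodule.projection_apply_mem _ _⟩, ?_⟩
    have h : evalBase E H F (X - projComplement H F Q X) = 0 := sub_projComplement_mem Q X
    rw [map_sub, sub_eq_zero] at h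
    exact h.symm
  obtain ⟨x, rfl⟩ := hex u
  obtain ⟨y, rfl⟩ := hex v
  have h := parseval_of_orthonormal (B := (metricForm E g).restrict (complementSpace H F Q))
    (b := b) hb x y
  simp only [hN, map_neg, neg_mul_neg]
  exact h

/-- A bound on the sectional curvature, in terms of the structure constants of an orthonormal
basis of `𝔪`. -/
theorem abs_structure_constants_le (hM : IsHomogeneousSpace E H F) {g : SmoothMetric F (G ⧸ H)}
    (hg : IsInvariantMetric g) {C : ℝ} (hC : SecBoundedBy g C)
    {b : Module.Basis ι ℝ (complementSpace H F Q)} (hb : IsMetricOrthonormal Q g b)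
    {i j : ι} (hij : i ≠ j) :
    |∑ k, ((metricForm E g ⁅(b i).1, (b j).1⁆ (b k) + metricForm E g ⁅(b i).1, (b k).1⁆ (b j) +
          metricForm E g ⁅(b j).1, (b k).1⁆ (b i)) / 2) ^ 2 -
        ∑ k, (metricForm E g ⁅(b i).1, (b i).1⁆ (b k) + metricForm E g ⁅(b i).1, (b k).1⁆ (b i) +
            metricForm E g ⁅(b i).1, (b k).1⁆ (b i)) / 2 *
          ((metricForm E g ⁅(b j).1, (b j).1⁆ (b k) + metricForm E g ⁅(b j).1, (b k).1⁆ (b j) +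
            metricForm E g ⁅(b j).1, (b k).1⁆ (b j)) / 2) -
        ∑ k, metricForm E g ⁅(b i).1, (b j).1⁆ (b k) ^ 2 -
        metricForm E g ⁅(b i).1, ⁅(b i).1, (b j).1⁆⁆ (b j)| ≤ C := by
  obtain ⟨conn, hc, hsec⟩ := hC
  have hK := isKillingFamily_fundamentalField hM hg
  have hin := inner_fundamentalField_base (E := E) hM g
  have hGam : ∀ X Y Z : GroupLieAlgebra 𝓘(ℝ, E) G,
      g.inner ((1 : G) : G ⧸ H) (conn (fundamentalField H F Y) ((1 : G) : G ⧸ H)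
        (fundamentalField H F X ((1 : G) : G ⧸ H))) (fundamentalField H F Z ((1 : G) : G ⧸ H)) =
      (metricForm E g ⁅X, Y⁆ Z + metricForm E g ⁅X, Z⁆ Y + metricForm E g ⁅Y, Z⁆ X) / 2 := by
    intro X Y Z
    have h := hK.two_inner_conn hc X Y Z ((1 : G) : G ⧸ H)
    rw [hin, hin, hin, metricForm_symm g X] at h
    linarith
  have hb' : ∀ i j, metricForm E g (b i) (b j) = if i = j then 1 else 0 := hb
  have hlin : LinearIndependent ℝ ![fundamentalField H F (b i).1 ((1 : G) : G ⧸ H),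
      fundamentalField H F (b j).1 ((1 : G) : G ⧸ H)] := by
    rw [LinearIndependent.pair_iff]
    intro s t h
    have h1 := congrArg (fun w => g.inner ((1 : G) : G ⧸ H) w
      (fundamentalField H F (b i).1 ((1 : G) : G ⧸ H))) h
    have h2 := congrArg (fun w => g.inner ((1 : G) : G ⧸ H) w
      (fundamentalField H F (b j).1 ((1 : G) : G ⧸ H))) h
    simp [hin, hb', hij, hij.symm] at h1 h2
    exact ⟨h1, h2⟩
  have hs := hsec _ _ (hK.smooth (b i).1) (hK.smooth (b j).1) ((1 : G) : G ⧸ H) hlin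
  -- Orthonormality makes the denominator $1$, so the bound applies to the numerator itself.
  rw [sectionalCurvature, hin, hin, hin, hb', hb', hb', if_pos rfl, if_pos rfl, if_neg hij] at hs
  rw [hK.inner_curvature hc, one_mul, zero_pow two_ne_zero, sub_zero, div_one,
    inner_base_eq_sum Q hM g hb, inner_base_eq_sum Q hM g hb (conn _ _ _) (conn _ _ _),
    inner_base_eq_sum Q hM g hb (fundamentalField H F ⁅(b i).1, (b j).1⁆ _), hin] at hs
  simp only [hGam, hin, ← sq] at hs
  exact hs

end Estimate

/-! ### The uniform bound and the conclusion -/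

section Final

variable {E : Type*} [NormedAddCommGroup E] [NormedSpace ℝ E] [FiniteDimensional ℝ E]
  {G : Type*} [TopologicalSpace G] [ChartedSpace E G] [Group G]
  {H : Subgroup G}
  {F : Type*} [NormedAddCommGroup F] [NormedSpace ℝ F] [FiniteDimensional ℝ F]
  [ChartedSpace F (G ⧸ H)] [LieGroup 𝓘(ℝ, E) ∞ G] [IsManifold 𝓘(ℝ, F) ∞ (G ⧸ H)]
  (Q : AdInvariantInnerProduct (E := E) G)
  {ι : Type*} [Fintype ι] [DecidableEq ι]

theorem form_projComplement (x : GroupLieAlgebra 𝓘(ℝ, E) G) (y : complementSpace H F Q) :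
    Q.form (projComplement H F Q x) y = Q.form x y := by
  have h : Q.form (x - projComplement H F Q x) y = 0 := y.2 _ (sub_projComplement_mem Q x)
  rw [map_sub, LinearMap.sub_apply] at h
  linarith

theorem metricForm_projComplement (g : SmoothMetric F (G ⧸ H)) (x y : GroupLieAlgebra 𝓘(ℝ, E) G) :
    metricForm E g (projComplement H F Q x) y = metricForm E g x y := by
  have h := metricForm_eq_zero g (sub_projComplement_mem Q x) y
  rw [map_sub, LinearMap.sub_apply] at h
  linarith

theorem form_projIsotropy_le (x : GroupLieAlgebra 𝓘(ℝ, E) G) :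
    Q.form (projIsotropy H F Q x) (projIsotropy H F Q x) ≤ Q.form x x := by
  have hx : projIsotropy H F Q x + projComplement H F Q x = x :=
    Submodule.projection_add_projection_eq_self (isCompl_isotropy_complement H (F := F) Q) x
  have h1 : Q.form (projIsotropy H F Q x) (projComplement H F Q x) = 0 :=
    (Submodule.projection_apply_mem (isCompl_isotropy_complement H (F := F) Q).symm x :
      projComplement H F Q x ∈ complementSpace H F Q) _
      (Submodule.projection_apply_mem (isCompl_isotropy_complement H (F := F) Q) x)
  have h2 : 0 ≤ Q.form (projComplement H F Q x) (projComplement H F Q x) := by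
    by_cases h0 : projComplement H F Q x = 0
    · rw [h0]; simp
    · exact (Q.pos _ h0).le
  have h3 : Q.form x x = Q.form (projIsotropy H F Q x + projComplement H F Q x)
    (projIsotropy H F Q x + projComplement H F Q x) := by rw [hx]
  rw [h3]
  simp only [map_add, LinearMap.add_apply]
  rw [Q.symm (projComplement H F Q x) (projIsotropy H F Q x), h1]
  linarith

/-- This is how the normalization is used: smallest eigenvalue $1$ means $Q\le g$ on $\mathfrak m$.
-/
theorem form_le_metricForm {g : SmoothMetric F (G ⧸ H)} (h : IsLeast (metricEigenvalues Q g) 1)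
    (x : complementSpace H F Q) : Q.form x.1 x.1 ≤ metricForm E g x.1 x.1 := by
  have : FiniteDimensional ℝ (GroupLieAlgebra 𝓘(ℝ, E) G) := inferInstanceAs (FiniteDimensional ℝ E)
  have := le_of_le_eigenvalues (B := Q.form.restrict (complementSpace H F Q))
    (φ := (metricForm E g).restrict (complementSpace H F Q)) (c := 1) (fun x y => Q.symm x y)
    (fun x hx => Q.pos x (by simpa using hx)) (fun x y => metricForm_symm g x.1 y.1)
    (fun l x hx hl => h.2 ⟨x, x.2, by simpa using hx, fun y hy => hl ⟨y, hy⟩⟩) x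
  rwa [one_mul] at this

theorem bracket_norm_bound (hM : IsHomogeneousSpace E H F) {κ : ℝ} (hκ0 : 0 ≤ κ)
    (hκ : ∀ x y : GroupLieAlgebra 𝓘(ℝ, E) G,
      Q.form ⁅x, y⁆ ⁅x, y⁆ ≤ κ * (Q.form x x * Q.form y y))
    {g : SmoothMetric F (G ⧸ H)} (hg : IsInvariantMetric g)
    (hmin : IsLeast (metricEigenvalues Q g) 1) {C : ℝ} (hC0 : 0 ≤ C) (hC : SecBoundedBy g C)
    {b : Module.Basis ι ℝ (complementSpace H F Q)} (hb : IsMetricOrthonormal Q g b) :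
    bracketIsotropyNormSq Q b + bracketComplementNormSq Q g b ≤ Fintype.card ι ^ 2 * κ +
      4 * (Fintype.card ι ^ 2 * C +
        Fintype.card ι * (Module.finrank ℝ (complementSpace H F Q) * κ)) := by
  have : LieGroup 𝓘(ℝ, E) (minSmoothness ℝ 3) G :=
    LieGroup.of_le (n := ∞) (by simp only [minSmoothness_of_isRCLikeNormedField]; norm_cast)
  have : FiniteDimensional ℝ (GroupLieAlgebra 𝓘(ℝ, E) G) := inferInstanceAs (FiniteDimensional ℝ E)
  have : CompleteSpace E := FiniteDimensional.complete ℝ E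
  have hle := form_le_metricForm Q hmin
  have hb' : ∀ i j, metricForm E g (b i) (b j) = if i = j then 1 else 0 := hb
  refine add_le_add ?_ ?_
  · have h1 : ∀ i, Q.form (b i) (b i) ≤ 1 := fun i => by simpa [hb'] using hle (b i)
    have h0 : ∀ i, 0 ≤ Q.form (b i) (b i) := fun i =>
      (Q.pos _ (by simpa using b.ne_zero i)).le
    have h2 : bracketIsotropyNormSq Q b ≤ ∑ _i : ι, ∑ _j : ι, κ := by
      refine Finset.sum_le_sum fun i _ => Finset.sum_le_sum fun j _ => ?_
      refine (form_projIsotropy_le Q _).trans ((hκ _ _).trans ?_)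
      exact mul_le_of_le_one_right hκ0 (mul_le_one₀ (h1 i) (h0 j) (h1 j))
    refine h2.trans_eq ?_
    simp only [Finset.sum_const, Finset.card_univ, nsmul_eq_mul]
    ring
  · have h := sum_bracket_estimate (V := GroupLieAlgebra 𝓘(ℝ, E) G) (m := complementSpace H F Q)
      (Q := Q.form) (φ := metricForm E g) Q.symm Q.pos (adInvariant_skew Q)
      (Submodule.projectionOnto _ _ (isCompl_isotropy_complement H (F := F) Q).symm)
      (form_projComplement Q) (fun x y => metricForm_projComplement Q g x y) hle hκ0 hκ hb'
      (C := C) (fun i j => by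
        -- On the diagonal there is no plane, but the expression vanishes identically.
        rcases eq_or_ne i j with rfl | hij
        · simpa [lie_self, ← sq] using hC0
        · exact abs_structure_constants_le Q hM hg hC hb hij)
    refine le_of_eq_of_le ?_ h
    refine Finset.sum_congr rfl fun i _ => Finset.sum_congr rfl fun j _ => ?_
    -- Parseval writes $|[b_i,b_j]_{\mathfrak m}|_g^2$ as $\sum_k c_{ijk}^2$; the projection drops
    -- out because the form vanishes on $\mathfrak h$.
    have hp := parseval_of_orthonormal
      (B := (metricForm E g).restrict (complementSpace H F Q)) (b := b) hb
      ⟨projComplement H F Q ⁅(b i).1, (b j).1⁆, Submodule.projection_apply_mem _ _⟩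
      ⟨projComplement H F Q ⁅(b i).1, (b j).1⁆, Submodule.projection_apply_mem _ _⟩
    refine Eq.trans hp (Finset.sum_congr rfl fun k _ => ?_)
    rw [← sq]
    exact congrArg (· ^ 2) (metricForm_projComplement Q g _ _)

end Final

theorem mainTheorem7
    {E : Type*} [NormedAddCommGroup E] [NormedSpace ℝ E] [FiniteDimensional ℝ E]
    {G : Type*} [TopologicalSpace G] [ChartedSpace E G] [Group G]
    [LieGroup 𝓘(ℝ, E) ∞ G] [CompactSpace G]
    (H : Subgroup G) (hH : IsClosed (H : Set G))
    {F : Type*} [NormedAddCommGroup F] [NormedSpace ℝ F] [FiniteDimensional ℝ F]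
    [ChartedSpace F (G ⧸ H)] [IsManifold 𝓘(ℝ, F) ∞ (G ⧸ H)]
    (hM : IsHomogeneousSpace E H F) [ConnectedSpace (G ⧸ H)]
    (hae : Finite H.normalCore)
    (Q : AdInvariantInnerProduct (E := E) G)
    (g : ℕ → SmoothMetric F (G ⧸ H)) (hg : ∀ n, IsInvariantMetric (g n))
    (hnorm : IsNormalizedMostShrinking Q g) (hcurv : HasBoundedCurvature g) :
    IsAlgebraicallyNonCollapsed Q g := by
  have : LieGroup 𝓘(ℝ, E) (minSmoothness ℝ 3) G :=
    LieGroup.of_le (n := ∞) (by simp only [minSmoothness_of_isRCLikeNormedField]; norm_cast)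
  have : FiniteDimensional ℝ (GroupLieAlgebra 𝓘(ℝ, E) G) := inferInstanceAs (FiniteDimensional ℝ E)
  have : CompleteSpace E := FiniteDimensional.complete ℝ E
  obtain ⟨C, hC0, hC⟩ := hcurv
  -- `κ` depends only on the bracket and `Q`, hence is uniform in `n`.
  obtain ⟨κ, hκ0, hκ⟩ := exists_bilinear_bound (B := Q.form) Q.symm Q.pos
    (LinearMap.mk₂ ℝ (fun x y : GroupLieAlgebra 𝓘(ℝ, E) G => ⁅x, y⁆) add_lie smul_lie lie_add
      (fun c x y => lie_smul c x y))
  -- The constant is the bound plus one, which gives both positivity and the strict inequality.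
  refine ⟨_, ?_, fun n b hb => lt_of_le_of_lt
    (bracket_norm_bound Q hM hκ0 hκ (hg n) (hnorm n) hC0.le (hC n) hb) (lt_add_one _)⟩
  positivity

end
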